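/- Let $d\ge 1$, and let $G$ be a compact group acting continuously on $\mathbb R^d$ by linear isometries, with normalized Haar measure $\mu$. For unit vectors $x,z\in\mathbb S^{d-1}$ define the distance between their orbits $$d_G(x,z)=\frac1{\sqrt{2\pi d}}\int_G\int_G\|gx-g'z\|_2\,d\mu(g)\,d\mu(g').$$ Let $\varepsilon\in(0,1)$ and $s=1+\varepsilon$. A random template $t$ is obtained from a Gaussian vector $\nu\sim\mathcal N(0,\frac1d I_d)$ by setting $t=\nu$ if $\|\nu\|_2^2<1+\varepsilon$, and $t=\perp$ (rejected) otherwise. Draw $m$ independent templates $t_1,\dots,t_m$ in this way and, independently of them, $|G|$ independent group elements $g_1,\dots,g_{|G|}$ with law $\mu$ (here $|G|$ denotes the number of sampled group elements). For a number $n$ of bins let $$\Phi(x)=\left[\frac{\sqrt s}{\sqrt{nm}\,|G|}\sum_{i=1}^{|G|}\mathbf 1_{\langle g_it_j,x\rangle\le sk/n}\right]_{j=1,\dots,m,\;k=-n,\dots,n}\in\mathbb R^{(2n+1)\times m},$$ where the indicator is $0$ if $t_j=\perp$. Put $$\delta_1(d,\varepsilon)=\frac{e^{-d\varepsilon^2/16}}{\sqrt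 d}-\frac12\,\frac{e^{-\varepsilon d/2}(1+\varepsilon)^{d/2}}{\sqrt d},\qquad \delta_2(d,\varepsilon)=\frac{e^{-d\varepsilon^2/16}}{\sqrt d}+(1+\varepsilon)e^{-d\varepsilon^2/8}.$$ There are universal constants $C_1,C_2>0$ such that the following holds for all $d$, $G$, $\varepsilon$ as above, all $\varepsilon_0,\delta\in(0,1)$, all $N\ge1$ and all $x_1,\dots,x_N\in\mathbb S^{d-1}$. If $$n\ge\frac3{\varepsilon_0},\qquad m\ge\frac{9C_1}{\varepsilon_0^2}\log\frac N\delta,\qquad |G|\ge\frac{9C_2}{\varepsilon_0^2}\log\frac{Nm}\delta,$$ then, with probability at least $1-2\delta$, simultaneously for all $i,j\in\{1,\dots,N\}$, $$\varepsilon-\delta_2(d,\varepsilon)-\varepsilon_0\;\le\;\langle\Phi(x_i),\Phi(x_j)\rangle-\bigl(1-d_G(x_i,x_j)\bigr)\;\le\;\varepsilon_0+\varepsilon+\delta_1(d,\varepsilon).$$ -/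

import Mathlib

open MeasureTheory ProbabilityTheory

noncomputable section

namespace InvariantFeatures

/-- Euclidean space `ℝ^d`. -/
abbrev E (d : ℕ) : Type := EuclideanSpace ℝ (Fin d)

/-- The Gaussian law `N(0, (1/d) I_d)` on `ℝ^d`. -/
def gaussianLaw (d : ℕ) : Measure (E d) :=
  multivariateGaussian 0 ((1 / (d : ℝ)) • (1 : Matrix (Fin d) (Fin d) ℝ))

/-- Sampling with rejection: the template drawn from the Gaussian vector `v` is `v` itself
if `‖v‖² < 1 + ε`, and it is `⊥` (here `none`) otherwise. -/
def template {d : ℕ} (ε : ℝ) (v : E d) : Option (E d) :=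
  open Classical in if ‖v‖ ^ 2 < 1 + ε then some v else none

variable {d : ℕ} {G : Type*} [Group G]

/-- The indicator of `⟨g t, x⟩ ≤ τ`; a rejected template `t = ⊥` contributes `0`. -/
def cdfIndicator (ρ : G →* (E d ≃ₗᵢ[ℝ] E d)) (g : G) (t : Option (E d)) (x : E d) (τ : ℝ) : ℝ :=
  open Classical in if ∃ v, t = some v ∧ inner ℝ (ρ g v) x ≤ τ then 1 else 0

/-- The entry `φ(x, t, s k / n)` of the feature map, for `m` templates, `n` bins and the sampled
group elements `g₁, …, g_r`:
`√s / (√(n m) r) * ∑ᵢ 1{⟨gᵢ t, x⟩ ≤ s k / n}`. -/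
def featureEntry (ρ : G →* (E d ≃ₗᵢ[ℝ] E d)) (s : ℝ) (n m : ℕ) {r : ℕ} (g : Fin r → G)
    (t : Option (E d)) (k : ℤ) (x : E d) : ℝ :=
  Real.sqrt s / (Real.sqrt ((n : ℝ) * m) * r) *
    ∑ i : Fin r, cdfIndicator ρ (g i) t x (s * k / n)

/-- The random feature map `Φ(x) ∈ ℝ^{m × (2n+1)}`, with entries indexed by the templates
`j = 1, …, m` and the thresholds `k = -n, …, n`. -/
def featureMap (ρ : G →* (E d ≃ₗᵢ[ℝ] E d)) (s : ℝ) (n : ℕ) {m r : ℕ} (t : Fin m → Option (E d))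
    (g : Fin r → G) (x : E d) :
    EuclideanSpace ℝ (Fin m × (Finset.Icc (-(n : ℤ)) (n : ℤ))) :=
  WithLp.toLp 2 fun p => featureEntry ρ s n m g (t p.1) (p.2 : ℤ) x

/-- The joint law of `m` independent Gaussian vectors (from which the templates are obtained by
rejection) and `r` independent group elements with law `μ`, independent of the vectors. -/
def sampleLaw (d m r : ℕ) [MeasurableSpace G] (μ : Measure G) :
    Measure ((Fin m → E d) × (Fin r → G)) :=
  (Measure.pi fun _ => gaussianLaw d).prod (Measure.pi fun _ => μ)

/-- The distance between orbits,
`d_G(x, z) = (2 π d)^{-1/2} ∫ ∫ ‖g x - g' z‖ dμ(g) dμ(g')`. -/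
def orbitDist (ρ : G →* (E d ≃ₗᵢ[ℝ] E d)) [MeasurableSpace G] (μ : Measure G) (x z : E d) : ℝ :=
  1 / Real.sqrt (2 * Real.pi * d) * ∫ g', ∫ g, ‖ρ g x - ρ g' z‖ ∂μ ∂μ

/-- The upper truncation term `δ₁(d, ε)`. -/
def delta₁ (d : ℕ) (ε : ℝ) : ℝ :=
  Real.exp (-(d * ε ^ 2 / 16)) / Real.sqrt d -
    1 / 2 * (Real.exp (-(ε * d / 2)) * (1 + ε) ^ ((d : ℝ) / 2) / Real.sqrt d)

/-- The lower truncation term `δ₂(d, ε)`. -/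
def delta₂ (d : ℕ) (ε : ℝ) : ℝ :=
  Real.exp (-(d * ε ^ 2 / 16)) / Real.sqrt d + (1 + ε) * Real.exp (-(d * ε ^ 2 / 8))

end InvariantFeatures

end

/-!
Write `s = 1 + ε`. For one accepted template `v` and fixed group elements `g, g'`, the sum over the
thresholds `s k / n` of the product of the two indicators, times `s / n`, is a Riemann sum of
`∫_{-s}^{s} 1{⟨g v, x⟩ ≤ τ} 1{⟨g' v, z⟩ ≤ τ} dτ = s - max ⟨g v, x⟩ ⟨g' v, z⟩`, and it exceeds this
integral by at most `s / n ≤ 2 ε₀ / 3` (`riemannSum_threshold_mem_Icc`).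

Because `max a b = (a + b) / 2 + |a - b| / 2`, because the Gaussian law is symmetric, and because
`E |⟨v, u⟩| = 2 ‖u‖ / √(2 π d)`, the Gaussian expectation of this kernel would be
`s - ‖g⁻¹ x - g'⁻¹ z‖ / √(2 π d)` if no template were rejected. Rejection, of probability `Q`,
subtracts `s Q` and adds back half of the mean of `|⟨v, u⟩|` over the rejected templates
(`integral_limitKernel_eq`). The Chernoff bound for the chi-square tail and Cauchy–Schwarz bound
these terms by `delta₂` and `delta₁`; the negative part of `delta₁` comes from the monotonicity of
`y - y ^ 2 / 2` on `[0, 1]` rather than from a lower bound on the tail (`integral_limitKernel_le`).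
Integrating over the group turns the distance into `orbitDist`, by the invariance of `μ` under
inversion (`integral_templateKernel_mem_Icc`).

The remaining `ε₀ / 3` pays for two concentration steps. The empirical distribution functions enter
`⟨Φ(x), Φ(z)⟩` only through their deviations from the exact ones averaged over all thresholds and
all templates (`abs_inner_featureMap_sub_le`). By the convexity of the exponential, such an average
has the same sub-Gaussian tail as a single deviation
(`measureReal_average_abs_sampleMean_sub_ge_le`), so a union bound over the `N` points suffices and
the number `n` of bins does not enter. Hoeffding's inequality for the average of the template
kernels and a union bound over the `N ^ 2` pairs finish the proof. For `δ ≥ 1 / 2` there is nothing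
to prove; for `δ < 1 / 2` a power of `δ` absorbs the constant factors of the union bounds.
-/

namespace InvariantFeatures

/-! ### Concentration of empirical means, averaged over a family of functions -/

/-- Hoeffding's bound on the exponential moments of the error of a sample mean. -/
theorem integral_exp_mul_sampleMean_sub_le {Ω : Type*} [MeasurableSpace Ω] (μ : Measure Ω)
    [IsProbabilityMeasure μ] {f : Ω → ℝ} (hf : Measurable f) (h01 : ∀ ω, f ω ∈ Set.Icc (0 : ℝ) 1)
    {r : ℕ} (hr : 0 < r) (c : ℝ) :
    ∫ g, Real.exp (c * ((∑ i, f (g i)) / r - ∫ ω, f ω ∂μ)) ∂(Measure.pi fun _ : Fin r => μ) ≤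
      Real.exp (c ^ 2 / (8 * r)) := by
  have hsub : ∀ i ∈ (Finset.univ : Finset (Fin r)),
      HasSubgaussianMGF (fun g : Fin r → Ω => f (g i) - ∫ ω, f ω ∂μ) ((‖(1 : ℝ) - 0‖₊ / 2) ^ 2)
        (Measure.pi fun _ : Fin r => μ) := by
    intro i _
    have h := hasSubgaussianMGF_of_mem_Icc (μ := μ) hf.aemeasurable
      (Filter.Eventually.of_forall h01)
    have hmp := measurePreserving_eval (fun _ : Fin r => μ) i
    rw [← hmp.map_eq] at h
    have h2 := HasSubgaussianMGF.of_map hmp.measurable.aemeasurable h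
    rw [hmp.map_eq] at h2
    exact h2
  have hind : iIndepFun (fun (i : Fin r) (g : Fin r → Ω) => f (g i) - ∫ ω, f ω ∂μ)
      (Measure.pi fun _ : Fin r => μ) :=
    iIndepFun_pi (μ := fun _ : Fin r => μ) (X := fun _ ω => f ω - ∫ ω, f ω ∂μ)
      fun i => (hf.sub_const _).aemeasurable
  have hsum := (HasSubgaussianMGF.sum_of_iIndepFun hind hsub).mgf_le (c / r)
  have hr' : (0 : ℝ) < r := by exact_mod_cast hr
  calc _ = mgf (fun g : Fin r → Ω => ∑ i, (f (g i) - ∫ ω, f ω ∂μ))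
        (Measure.pi fun _ : Fin r => μ) (c / r) := by
        unfold mgf
        refine integral_congr_ae (Filter.Eventually.of_forall fun g => ?_)
        simp only [Finset.sum_sub_distrib, Finset.sum_const, Finset.card_univ, Fintype.card_fin,
          nsmul_eq_mul]
        congr 1
        field_simp
    _ ≤ _ := hsum
    _ = _ := by
        congr 1
        simp
        field_simp
        ring

/-- Hoeffding's inequality for the average, over a finite family of functions, of the absolute
errors of the sample means. The bound does not depend on the size of the family. -/
theorem measureReal_average_abs_sampleMean_sub_ge_le {Ω K : Type*} [MeasurableSpace Ω]
    (μ : Measure Ω) [IsProbabilityMeasure μ] [Fintype K] [Nonempty K] {f : K → Ω → ℝ}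
    (hf : ∀ k, Measurable (f k)) (h01 : ∀ k ω, f k ω ∈ Set.Icc (0 : ℝ) 1)
    {r : ℕ} (hr : 0 < r) {t : ℝ} (ht : 0 ≤ t) :
    (Measure.pi fun _ : Fin r => μ).real
        {g | t ≤ (∑ k, |(∑ i, f k (g i)) / r - ∫ ω, f k ω ∂μ|) / Fintype.card K} ≤
      2 * Real.exp (-(2 * r * t ^ 2)) := by
  set P : Measure (Fin r → Ω) := Measure.pi fun _ : Fin r => μ with hP
  set e : K → (Fin r → Ω) → ℝ := fun k g => (∑ i, f k (g i)) / r - ∫ ω, f k ω ∂μ with he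
  have hr' : (0 : ℝ) < r := by exact_mod_cast hr
  have hK : (0 : ℝ) < Fintype.card K := by exact_mod_cast Fintype.card_pos
  -- the choice of the exponent that optimizes the Chernoff bound
  set c : ℝ := 4 * r * t with hc
  have hc0 : 0 ≤ c := by positivity
  have hem : ∀ k, Measurable (e k) := fun k => by
    have := hf k
    simp only [he]
    fun_prop
  have hmean : ∀ k, ∫ ω, f k ω ∂μ ∈ Set.Icc (0 : ℝ) 1 := fun k =>
    ⟨integral_nonneg fun ω => (h01 k ω).1, by
      calc ∫ ω, f k ω ∂μ ≤ ∫ _, (1 : ℝ) ∂μ :=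
            integral_mono_of_nonneg (Filter.Eventually.of_forall fun ω => (h01 k ω).1)
              (integrable_const _) (Filter.Eventually.of_forall fun ω => (h01 k ω).2)
        _ = 1 := by simp⟩
  have heb : ∀ k g, |e k g| ≤ 1 := fun k g => by
    have h1 : 0 ≤ (∑ i, f k (g i)) / r :=
      div_nonneg (Finset.sum_nonneg fun i _ => (h01 k (g i)).1) hr'.le
    have h2 : (∑ i, f k (g i)) / r ≤ 1 := by
      rw [div_le_one hr']
      calc ∑ i, f k (g i) ≤ ∑ _i : Fin r, (1 : ℝ) := Finset.sum_le_sum fun i _ => (h01 k (g i)).2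
        _ = r := by simp
    have := hmean k
    simp only [he, abs_le]
    constructor <;> linarith [this.1, this.2]
  have hint : ∀ (a : ℝ) k, Integrable (fun g => Real.exp (a * e k g)) P := fun a k =>
    Integrable.of_bound ((hem k).const_mul a).exp.aestronglyMeasurable (Real.exp |a|)
      (Filter.Eventually.of_forall fun g => by
        rw [Real.norm_eq_abs, Real.abs_exp, Real.exp_le_exp]
        calc a * e k g ≤ |a * e k g| := le_abs_self _
          _ = |a| * |e k g| := abs_mul _ _
          _ ≤ |a| * 1 := by gcongr; exact heb k g
          _ = |a| := mul_one _)
  set A : (Fin r → Ω) → ℝ := fun g => (∑ k, |e k g|) / Fintype.card K with hA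
  have hAm : Measurable A := by
    have := fun k => (hem k).abs
    simp only [hA]
    fun_prop
  -- convexity of the exponential replaces the average by the individual deviations
  have hconv : ∀ g, Real.exp (c * A g) ≤
      (∑ k, (Real.exp (c * e k g) + Real.exp (-c * e k g))) / Fintype.card K := fun g => by
    have hj := convexOn_exp.map_sum_le (t := (Finset.univ : Finset K))
      (w := fun _ => (Fintype.card K : ℝ)⁻¹) (p := fun k => c * |e k g|)
      (fun _ _ => by positivity) (by simp [hK.ne']) (fun _ _ => Set.mem_univ _)
    simp only [smul_eq_mul, ← Finset.mul_sum] at hj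
    rw [div_eq_inv_mul]
    refine le_trans (le_of_eq ?_) (hj.trans ?_)
    · congr 1; simp only [hA]; ring
    · gcongr with k
      rcases abs_cases (e k g) with h | h <;> rw [h.1]
      · exact le_add_of_nonneg_right (Real.exp_pos _).le
      · rw [mul_neg, ← neg_mul]
        exact le_add_of_nonneg_left (Real.exp_pos _).le
  have hrint : Integrable (fun g => (∑ k, (Real.exp (c * e k g) + Real.exp (-c * e k g))) /
      (Fintype.card K : ℝ)) P :=
    (integrable_finsetSum _ fun k _ => (hint c k).add (hint (-c) k)).div_const _
  have hAint : Integrable (fun g => Real.exp (c * A g)) P :=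
    hrint.mono' (hAm.const_mul c).exp.aestronglyMeasurable
      (Filter.Eventually.of_forall fun g => by
        rw [Real.norm_eq_abs, Real.abs_exp]; exact hconv g)
  have hmgf : mgf A P c ≤ 2 * Real.exp (c ^ 2 / (8 * r)) := by
    calc mgf A P c ≤ ∫ g, (∑ k, (Real.exp (c * e k g) + Real.exp (-c * e k g))) /
          (Fintype.card K : ℝ) ∂P := integral_mono hAint hrint hconv
      _ = (∑ k, (∫ g, Real.exp (c * e k g) ∂P + ∫ g, Real.exp (-c * e k g) ∂P)) /
          (Fintype.card K : ℝ) := by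
          have hs := integral_finsetSum (μ := P) Finset.univ
            fun k _ => (hint c k).add (hint (-c) k)
          simp only [Pi.add_apply] at hs
          rw [integral_div, hs]
          congr 1
          exact Finset.sum_congr rfl fun k _ => integral_add (hint c k) (hint (-c) k)
      _ ≤ (∑ _k : K, 2 * Real.exp (c ^ 2 / (8 * r))) / (Fintype.card K : ℝ) := by
          gcongr with k
          have h1 := integral_exp_mul_sampleMean_sub_le μ (hf k) (h01 k) hr c
          have h2 := integral_exp_mul_sampleMean_sub_le μ (hf k) (h01 k) hr (-c)
          rw [neg_sq] at h2
          linarith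
      _ = _ := by
          simp only [Finset.sum_const, Finset.card_univ, nsmul_eq_mul]
          field_simp
  calc P.real {g | t ≤ A g} ≤ Real.exp (-c * t) * mgf A P c :=
        measure_ge_le_exp_mul_mgf t hc0 hAint
    _ ≤ Real.exp (-c * t) * (2 * Real.exp (c ^ 2 / (8 * r))) := by gcongr
    _ = 2 * Real.exp (-(2 * r * t ^ 2)) := by
        rw [mul_left_comm, ← Real.exp_add]
        congr 2
        simp only [hc]
        field_simp
        ring

/-! ### Moments and tails of the Gaussian law -/

instance isGaussian_gaussianLaw (d : ℕ) : IsGaussian (gaussianLaw d) := by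
  unfold gaussianLaw; infer_instance

theorem posSemidef_scalar (d : ℕ) :
    ((1 / (d : ℝ)) • (1 : Matrix (Fin d) (Fin d) ℝ)).PosSemidef :=
  Matrix.PosSemidef.one.smul (by positivity)

theorem dotProduct_scalar_mulVec {d : ℕ} (u : E d) :
    dotProduct u.ofLp (((1 / (d : ℝ)) • (1 : Matrix (Fin d) (Fin d) ℝ)).mulVec u.ofLp) =
      ‖u‖ ^ 2 / d := by
  rw [Matrix.smul_mulVec, Matrix.one_mulVec, dotProduct_smul, EuclideanSpace.real_norm_sq_eq,
    smul_eq_mul, one_div_mul_eq_div]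
  simp only [dotProduct, ← pow_two]

/-- The Gaussian vector has independent `N(0, 1 / d)` coordinates. -/
theorem gaussianLaw_eq_map_pi (d : ℕ) :
    gaussianLaw d = (Measure.pi fun _ : Fin d => gaussianReal 0 1).map
      (fun y => (Real.sqrt (1 / d)) • WithLp.toLp 2 y) := by
  have h : (fun y : Fin d → ℝ => (Real.sqrt (1 / d)) • WithLp.toLp 2 y) =
    (fun v : E d => Real.sqrt (1 / d) • v) ∘ (WithLp.toLp 2) := rfl
  rw [h, ← Measure.map_map (by fun_prop) (by fun_prop), map_pi_eq_stdGaussian]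
  apply Measure.ext_of_charFun
  ext t
  rw [charFun_map_smul, charFun_stdGaussian, gaussianLaw, charFun_multivariateGaussian
    (posSemidef_scalar d)]
  congr 1
  rw [← Complex.ofReal_pow, norm_smul, mul_pow, Real.norm_eq_abs, sq_abs,
    Real.sq_sqrt (by positivity)]
  rw [dotProduct_scalar_mulVec, inner_zero_right, Complex.ofReal_zero, zero_mul, zero_sub, neg_div,
    one_div_mul_eq_div]

theorem gaussianLaw_map_inner (d : ℕ) (u : E d) :
    (gaussianLaw d).map (fun v => inner ℝ v u) =
      gaussianReal 0 (‖u‖ ^ 2 / d).toNNReal := by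
  apply Measure.ext_of_charFun
  ext t
  have : (fun v : E d => inner ℝ v u) = (innerSL ℝ u : E d → ℝ) := by
    ext v; simp [real_inner_comm]
  rw [this, IsGaussian.map_eq_gaussianReal]
  congr 2
  · rw [ContinuousLinearMap.integral_comp_id_comm]
    · simp [gaussianLaw]
    · exact IsGaussian.integrable_id
  · rw [← covariance_self (by fun_prop)]
    have := covarianceBilin_apply_eq_cov (μ := gaussianLaw d) IsGaussian.memLp_two_id u u
    rw [show (⇑((innerSL ℝ) u) : E d → ℝ) = fun v => inner ℝ u v from rfl, ← this,
      gaussianLaw, covarianceBilin_multivariateGaussian (posSemidef_scalar d)]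
    rw [dotProduct_scalar_mulVec]

theorem integral_abs_gaussianReal (w : NNReal) :
    ∫ x, |x| ∂(gaussianReal 0 w) = Real.sqrt (2 * w / Real.pi) := by
  rcases eq_or_ne w 0 with rfl | hw
  · simp
  have hw' : (0 : ℝ) < w := by positivity
  have hI : ∫ x in Set.Ioi (0 : ℝ), x * Real.exp (-(1 / (2 * (w : ℝ))) * x ^ 2) = w := by
    have h := integral_mul_cexp_neg_mul_sq (b := ((1 / (2 * (w : ℝ)) : ℝ) : ℂ))
      (by rw [Complex.ofReal_re]; positivity)
    have h2 : ∫ x in Set.Ioi (0 : ℝ), (((x * Real.exp (-(1 / (2 * (w : ℝ))) * x ^ 2) : ℝ)) : ℂ)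
        = ((w : ℝ) : ℂ) := by
      push_cast at h ⊢
      rw [h]
      field_simp
    rw [integral_complex_ofReal] at h2
    exact_mod_cast h2
  rw [integral_gaussianReal_eq_integral_smul hw]
  have : ∀ x : ℝ, gaussianPDFReal 0 w x • |x| = (fun y => (Real.sqrt (2 * Real.pi * w))⁻¹ *
      (y * Real.exp (-(1 / (2 * (w : ℝ))) * y ^ 2))) |x| := fun x => by
    simp only [gaussianPDFReal, sq_abs, sub_zero, smul_eq_mul]
    rw [show -x ^ 2 / (2 * (w : ℝ)) = -(1 / (2 * w)) * x ^ 2 by ring]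
    ring
  simp_rw [this]
  rw [integral_comp_abs (f := fun y => (Real.sqrt (2 * Real.pi * w))⁻¹ *
      (y * Real.exp (-(1 / (2 * (w : ℝ))) * y ^ 2))), integral_const_mul, hI]
  symm
  rw [Real.sqrt_eq_iff_mul_self_eq (by positivity) (by positivity)]
  have := Real.mul_self_sqrt (show 0 ≤ 2 * (w : ℝ) * Real.pi by positivity)
  field_simp
  rw [pow_two, this]

theorem integral_abs_inner_gaussianLaw (d : ℕ) (u : E d) :
    ∫ v, |inner ℝ v u| ∂(gaussianLaw d) = 2 * (1 / Real.sqrt (2 * Real.pi * d) * ‖u‖) := by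
  have h := integral_map (μ := gaussianLaw d) (φ := fun v => inner ℝ v u) (f := fun x : ℝ => |x|)
    (by fun_prop) (by fun_prop)
  rw [← h, gaussianLaw_map_inner, integral_abs_gaussianReal, Real.coe_toNNReal _ (by positivity)]
  rw [Real.sqrt_eq_iff_mul_self_eq (by positivity) (by positivity)]
  have := Real.mul_self_sqrt (show 0 ≤ 2 * Real.pi * (d : ℝ) by positivity)
  symm
  calc _ = 4 * ‖u‖ ^ 2 / (Real.sqrt (2 * Real.pi * d) * Real.sqrt (2 * Real.pi * d)) := by
        ring
    _ = _ := by
        rw [this]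
        rcases Nat.eq_zero_or_pos d with rfl | hd
        · simp
        · field_simp
          ring

theorem integral_inner_sq_gaussianLaw (d : ℕ) (u : E d) :
    ∫ v, (inner ℝ v u) ^ 2 ∂(gaussianLaw d) = ‖u‖ ^ 2 / d := by
  have h := integral_map (μ := gaussianLaw d) (φ := fun v => inner ℝ v u) (f := fun x : ℝ => x ^ 2)
    (by fun_prop) (by fun_prop)
  rw [← h, gaussianLaw_map_inner]
  have h2 := variance_fun_id_gaussianReal (μ := 0) (v := (‖u‖ ^ 2 / d).toNNReal)
  rw [variance_eq_integral (by fun_prop)] at h2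
  simp only [integral_id_gaussianReal, sub_zero] at h2
  rw [h2, Real.coe_toNNReal _ (by positivity)]

theorem gaussianLaw_map_neg (d : ℕ) : (gaussianLaw d).map (fun v => -v) = gaussianLaw d := by
  apply Measure.ext_of_charFun
  ext t
  have : (fun v : E d => -v) = fun v => (-1 : ℝ) • v := by ext; simp
  rw [this, charFun_map_smul, gaussianLaw, charFun_multivariateGaussian (posSemidef_scalar d),
    charFun_multivariateGaussian (posSemidef_scalar d)]
  simp [Matrix.mulVec_neg]

theorem integrable_abs_inner_gaussianLaw (d : ℕ) (u : E d) :
    Integrable (fun v => |inner ℝ v u|) (gaussianLaw d) := by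
  have : Integrable (fun v : E d => innerSL ℝ u v) (gaussianLaw d) :=
    (innerSL ℝ u).integrable_comp (IsGaussian.integrable_id (μ := gaussianLaw d))
  simpa [real_inner_comm] using this.abs

theorem integral_exp_mul_sq_gaussianReal {t : ℝ} (ht : t < 1 / 2) :
    ∫ x, Real.exp (t * x ^ 2) ∂(gaussianReal 0 1) = Real.sqrt (1 / (1 - 2 * t)) := by
  rw [integral_gaussianReal_eq_integral_smul one_ne_zero]
  have : ∀ x : ℝ, gaussianPDFReal 0 1 x • Real.exp (t * x ^ 2) =
      (Real.sqrt (2 * Real.pi))⁻¹ * Real.exp (-(1 / 2 - t) * x ^ 2) := fun x => by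
    simp only [gaussianPDFReal, sub_zero, smul_eq_mul, NNReal.coe_one, mul_one]
    rw [mul_assoc, ← Real.exp_add]
    congr 2
    ring
  simp_rw [this]
  rw [integral_const_mul, integral_gaussian, ← Real.sqrt_inv, ← Real.sqrt_mul (by positivity)]
  congr 1
  have : 1 / 2 - t ≠ 0 := by linarith
  have : 1 - 2 * t ≠ 0 := by linarith
  field_simp

theorem integrable_exp_mul_sq_gaussianReal {t : ℝ} (ht : t < 1 / 2) :
    Integrable (fun x => Real.exp (t * x ^ 2)) (gaussianReal 0 1) := by
  -- a non-integrable function would have integral `0`, but the integral is positive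
  by_contra h
  have h1 := integral_undef h
  rw [integral_exp_mul_sq_gaussianReal ht] at h1
  have : 0 < Real.sqrt (1 / (1 - 2 * t)) := Real.sqrt_pos.2 (by
    have : 0 < 1 - 2 * t := by linarith
    positivity)
  linarith

/-- The Chernoff bound for the upper tail of a chi-square law. -/
theorem measureReal_gaussianLaw_reject_le {d : ℕ} (hd : 0 < d) {ε : ℝ} (hε : 0 < ε) :
    (gaussianLaw d).real {v | 1 + ε ≤ ‖v‖ ^ 2} ≤
      Real.exp (-(ε * d / 2)) * (1 + ε) ^ ((d : ℝ) / 2) := by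
  have hd' : (0 : ℝ) < d := by exact_mod_cast hd
  -- the optimal exponent in the Chernoff bound
  set t : ℝ := ε / (2 * (1 + ε)) with htdef
  have ht0 : 0 ≤ t := by positivity
  have ht : t < 1 / 2 := by
    rw [htdef, div_lt_div_iff₀ (by positivity) (by norm_num)]; linarith
  have hnorm : ∀ y : Fin d → ℝ, d * ‖(Real.sqrt (1 / d)) • (WithLp.toLp 2 y : E d)‖ ^ 2 =
      ∑ i, y i ^ 2 := fun y => by
    rw [norm_smul, mul_pow, EuclideanSpace.real_norm_sq_eq, Real.norm_eq_abs, sq_abs,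
      Real.sq_sqrt (by positivity)]
    field_simp
  rw [gaussianLaw_eq_map_pi, map_measureReal_apply (by fun_prop)
    (measurableSet_le measurable_const (by fun_prop))]
  have hsub : (fun y : Fin d → ℝ => (Real.sqrt (1 / d)) • (WithLp.toLp 2 y : E d)) ⁻¹'
      {v | 1 + ε ≤ ‖v‖ ^ 2} = {y | d * (1 + ε) ≤ ∑ i, y i ^ 2} := by
    ext y
    simp only [Set.mem_preimage, Set.mem_ofPred_eq, ← hnorm]
    rw [mul_le_mul_iff_right₀ hd']
  rw [hsub]
  have hexp : ∀ y : Fin d → ℝ, Real.exp (t * ∑ i, y i ^ 2) = ∏ i, Real.exp (t * y i ^ 2) :=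
    fun y => by rw [Finset.mul_sum, Real.exp_sum]
  have hint : Integrable (fun y : Fin d → ℝ => Real.exp (t * ∑ i, y i ^ 2))
      (Measure.pi fun _ : Fin d => gaussianReal 0 1) := by
    simp_rw [hexp]
    exact Integrable.fintype_prod (f := fun _ x => Real.exp (t * x ^ 2))
      fun _ => integrable_exp_mul_sq_gaussianReal ht
  refine (measure_ge_le_exp_mul_mgf _ ht0 hint).trans (le_of_eq ?_)
  have hmgf : mgf (fun y : Fin d → ℝ => ∑ i, y i ^ 2)
      (Measure.pi fun _ : Fin d => gaussianReal 0 1) t = (1 + ε) ^ ((d : ℝ) / 2) := by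
    unfold mgf
    simp_rw [hexp]
    rw [integral_fintype_prod_eq_prod (f := fun _ x => Real.exp (t * x ^ 2)),
      Finset.prod_const, integral_exp_mul_sq_gaussianReal ht, Finset.card_univ, Fintype.card_fin]
    have : 1 / (1 - 2 * t) = 1 + ε := by
      rw [htdef]
      field_simp
      ring
    rw [this, Real.sqrt_eq_rpow, ← Real.rpow_natCast, ← Real.rpow_mul (by positivity)]
    congr 1
    ring
  rw [hmgf]
  congr 2
  rw [htdef]
  field_simp

/-! ### The expected kernel of one template -/

/-- The kernel of one template `v` after integrating out the threshold:
`∫_{-s}^{s} 1{⟨v, a⟩ ≤ τ} 1{⟨v, b⟩ ≤ τ} dτ = s - max ⟨v, a⟩ ⟨v, b⟩` for accepted `v`, with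
`s = 1 + ε`, and `0` for rejected `v`. -/
noncomputable def limitKernel {d : ℕ} (ε : ℝ) (a b v : E d) : ℝ :=
  {v : E d | ‖v‖ ^ 2 < 1 + ε}.indicator (fun v => 1 + ε - max (inner ℝ v a) (inner ℝ v b)) v

theorem measurableSet_accept (d : ℕ) (ε : ℝ) : MeasurableSet {v : E d | ‖v‖ ^ 2 < 1 + ε} :=
  measurableSet_lt (by fun_prop) measurable_const

theorem compl_accept (d : ℕ) (ε : ℝ) :
    {v : E d | ‖v‖ ^ 2 < 1 + ε}ᶜ = {v : E d | 1 + ε ≤ ‖v‖ ^ 2} := by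
  ext v; simp

theorem setIntegral_accept_inner (d : ℕ) (ε : ℝ) (u : E d) :
    ∫ v in {v : E d | ‖v‖ ^ 2 < 1 + ε}, inner ℝ v u ∂(gaussianLaw d) = 0 := by
  have h : ∫ v in {v : E d | ‖v‖ ^ 2 < 1 + ε}, inner ℝ v u ∂((gaussianLaw d).map (fun v => -v)) =
      ∫ v in {v : E d | ‖v‖ ^ 2 < 1 + ε}, -inner ℝ v u ∂(gaussianLaw d) := by
    rw [setIntegral_map (measurableSet_accept d ε) (by fun_prop) (by fun_prop)]
    simp
  rw [gaussianLaw_map_neg, integral_neg] at h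
  linarith

theorem integrable_inner_gaussianLaw (d : ℕ) (u : E d) :
    Integrable (fun v => inner ℝ v u) (gaussianLaw d) :=
  (integrable_norm_iff (by fun_prop)).1 (integrable_abs_inner_gaussianLaw d u)

theorem integrable_limitKernel {d : ℕ} (ε : ℝ) (a b : E d) :
    Integrable (limitKernel ε a b) (gaussianLaw d) :=
  ((integrable_const _).sub ((integrable_inner_gaussianLaw d a).sup
    (integrable_inner_gaussianLaw d b))).indicator (measurableSet_accept d ε)

/-- The expectation of the limiting kernel: the value without rejection, corrected by the two
contributions of the rejection event. -/
theorem integral_limitKernel_eq (d : ℕ) (ε : ℝ) (a b : E d) :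
    ∫ v, limitKernel ε a b v ∂(gaussianLaw d) =
      (1 + ε) * (1 - (gaussianLaw d).real {v | 1 + ε ≤ ‖v‖ ^ 2}) -
        1 / Real.sqrt (2 * Real.pi * d) * ‖a - b‖ +
        (∫ v in {v : E d | 1 + ε ≤ ‖v‖ ^ 2}, |inner ℝ v (a - b)| ∂(gaussianLaw d)) / 2 := by
  have hS := measurableSet_accept d ε
  have hmax : ∀ v : E d, 1 + ε - max (inner ℝ v a) (inner ℝ v b) =
      (1 + ε) - (1 / 2) * inner ℝ v (a + b) - (1 / 2) * |inner ℝ v (a - b)| := fun v => by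
    rw [inner_add_right, inner_sub_right]
    rcases le_total (inner ℝ v a : ℝ) (inner ℝ v b) with h | h
    · rw [max_eq_right h, abs_of_nonpos (by linarith)]; ring
    · rw [max_eq_left h, abs_of_nonneg (by linarith)]; ring
  have h1 := integrable_inner_gaussianLaw d (a + b)
  have h2 := integrable_abs_inner_gaussianLaw d (a - b)
  have hsplit := integral_add_compl hS h2
  rw [integral_abs_inner_gaussianLaw, compl_accept] at hsplit
  have hQ := probReal_add_probReal_compl (μ := gaussianLaw d) hS
  rw [compl_accept] at hQ
  unfold limitKernel
  rw [integral_indicator hS]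
  simp_rw [hmax]
  have h12 : Integrable (fun v : E d => 1 + ε - 1 / 2 * inner ℝ v (a + b)) (gaussianLaw d) :=
    (integrable_const _).sub (h1.const_mul _)
  rw [integral_sub h12.integrableOn (h2.const_mul _).integrableOn,
    integral_sub (integrable_const _) (h1.const_mul _).integrableOn, integral_const_mul,
    integral_const_mul, setIntegral_accept_inner, setIntegral_const, smul_eq_mul]
  linear_combination (1 + ε) * hQ - (1 / 2) * hsplit

/-- Cauchy–Schwarz on the rejection event. -/
theorem setIntegral_reject_abs_inner_le (d : ℕ) (ε : ℝ) (u : E d) :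
    ∫ v in {v : E d | 1 + ε ≤ ‖v‖ ^ 2}, |inner ℝ v u| ∂(gaussianLaw d) ≤
      Real.sqrt ((gaussianLaw d).real {v | 1 + ε ≤ ‖v‖ ^ 2}) * (‖u‖ / Real.sqrt d) := by
  have hR : MeasurableSet {v : E d | 1 + ε ≤ ‖v‖ ^ 2} :=
    measurableSet_le measurable_const (by fun_prop)
  have hL2 : MemLp (fun v : E d => |inner ℝ v u|) (ENNReal.ofReal 2) (gaussianLaw d) := by
    have : MemLp (fun v : E d => innerSL ℝ u v) 2 (gaussianLaw d) :=
      (IsGaussian.memLp_two_id (μ := gaussianLaw d)).continuousLinearMap_comp (innerSL ℝ u)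
    have h := this.norm
    simpa [real_inner_comm] using h
  have hone : MemLp ({v : E d | 1 + ε ≤ ‖v‖ ^ 2}.indicator (fun _ => (1 : ℝ))) (ENNReal.ofReal 2)
      (gaussianLaw d) := (memLp_const _).indicator hR
  have h := integral_mul_le_Lp_mul_Lq_of_nonneg (μ := gaussianLaw d) Real.HolderConjugate.two_two
    (f := {v : E d | 1 + ε ≤ ‖v‖ ^ 2}.indicator (fun _ => (1 : ℝ)))
    (g := fun v => |inner ℝ v u|)
    (Filter.Eventually.of_forall fun v => Set.indicator_nonneg (fun _ _ => zero_le_one) v)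
    (Filter.Eventually.of_forall fun v => abs_nonneg _) hone hL2
  have e1 : ∀ v : E d, {v : E d | 1 + ε ≤ ‖v‖ ^ 2}.indicator (fun _ => (1 : ℝ)) v *
      |inner ℝ v u| = {v : E d | 1 + ε ≤ ‖v‖ ^ 2}.indicator (fun v => |inner ℝ v u|) v :=
    fun v => by by_cases hv : 1 + ε ≤ ‖v‖ ^ 2 <;> simp [hv]
  have e2 : ∀ v : E d, {v : E d | 1 + ε ≤ ‖v‖ ^ 2}.indicator (fun _ => (1 : ℝ)) v ^ (2 : ℝ) =
      {v : E d | 1 + ε ≤ ‖v‖ ^ 2}.indicator 1 v :=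
    fun v => by by_cases hv : 1 + ε ≤ ‖v‖ ^ 2 <;> simp [hv]
  have e3 : ∀ v : E d, |inner ℝ v u| ^ (2 : ℝ) = (inner ℝ v u) ^ 2 := fun v => by
    rw [Real.rpow_two, sq_abs]
  simp_rw [e1, e2, e3] at h
  rw [integral_indicator hR, integral_indicator_one hR, integral_inner_sq_gaussianLaw,
    ← Real.sqrt_eq_rpow, ← Real.sqrt_eq_rpow, Real.sqrt_div (by positivity),
    Real.sqrt_sq (norm_nonneg _)] at h
  exact h

/-- The Chernoff bound of the chi-square tail in Gaussian form, by
`log (1 + ε) ≤ ε - ε ^ 2 / 4` on `(0, 1)`. -/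
theorem exp_mul_one_add_rpow_le {ε : ℝ} (hε : ε ∈ Set.Ioo (0 : ℝ) 1) (d : ℕ) :
    Real.exp (-(ε * d / 2)) * (1 + ε) ^ ((d : ℝ) / 2) ≤ Real.exp (-(d * ε ^ 2 / 8)) := by
  have h0 := hε.1
  have hlog : Real.log (1 + ε) ≤ ε - ε ^ 2 / 4 := by
    rw [Real.log_le_iff_le_exp (by linarith)]
    have hy : 0 ≤ ε - ε ^ 2 / 4 := by nlinarith [hε.2]
    refine le_trans ?_ (Real.quadratic_le_exp_of_nonneg hy)
    nlinarith [mul_nonneg (sq_nonneg ε) (sub_nonneg.2 hε.2.le), sq_nonneg (ε ^ 2)]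
  rw [Real.rpow_def_of_pos (by linarith), ← Real.exp_add, Real.exp_le_exp]
  have hd : (0 : ℝ) ≤ d / 2 := by positivity
  nlinarith [mul_le_mul_of_nonneg_right hlog hd]

/-- The rejection probability is smaller than its Chernoff bound, and `y - y² / 2` increases on
`[0, 1]`; so no lower bound on the rejection probability is needed for the negative term of
`delta₁`. -/
theorem integral_limitKernel_le {d : ℕ} (hd : 0 < d) {ε : ℝ} (hε : ε ∈ Set.Ioo (0 : ℝ) 1)
    {a b : E d} (ha : ‖a‖ = 1) (hb : ‖b‖ = 1) :
    ∫ v, limitKernel ε a b v ∂(gaussianLaw d) ≤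
      1 - 1 / Real.sqrt (2 * Real.pi * d) * ‖a - b‖ + ε + delta₁ d ε := by
  have h0 := hε.1
  have hd1 : (1 : ℝ) ≤ d := by exact_mod_cast hd
  have hsd : 1 ≤ Real.sqrt d := Real.one_le_sqrt.2 hd1
  have hQ := measureReal_gaussianLaw_reject_le hd h0
  have hL := exp_mul_one_add_rpow_le hε d
  have hCS := setIntegral_reject_abs_inner_le d ε (a - b)
  rw [integral_limitKernel_eq, delta₁]
  set Q := (gaussianLaw d).real {v | 1 + ε ≤ ‖v‖ ^ 2}
  set M := Real.exp (-(ε * d / 2)) * (1 + ε) ^ ((d : ℝ) / 2)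
  set F := Real.exp (-(d * ε ^ 2 / 16)) with hF
  have hFF : F ^ 2 = Real.exp (-(d * ε ^ 2 / 8)) := by
    rw [hF, ← Real.exp_nat_mul]; congr 1; push_cast; ring
  have hF0 : 0 < F := Real.exp_pos _
  have hF1 : F ≤ 1 := Real.exp_le_one_iff.2 (by rw [neg_nonpos]; positivity)
  have hQ0 : 0 ≤ Q := measureReal_nonneg
  have hM0 : 0 ≤ M := hQ0.trans hQ
  set q := Real.sqrt Q
  set l := Real.sqrt M
  have hq0 : 0 ≤ q := Real.sqrt_nonneg _
  have hqq : q ^ 2 = Q := Real.sq_sqrt hQ0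
  have hll : l ^ 2 = M := Real.sq_sqrt hM0
  have hql : q ≤ l := Real.sqrt_le_sqrt hQ
  have hlF : l ≤ F := by
    rw [← Real.sqrt_sq hF0.le, hFF]; exact Real.sqrt_le_sqrt hL
  have hab : ‖a - b‖ ≤ 2 := (norm_sub_le a b).trans (by rw [ha, hb]; norm_num)
  have hCS2 : q * (‖a - b‖ / Real.sqrt d) ≤ q * (2 / Real.sqrt d) := by gcongr
  have hmono : q - q ^ 2 / 2 ≤ l - l ^ 2 / 2 := by nlinarith
  have hmono2 : (q - q ^ 2 / 2) / Real.sqrt d ≤ (F - M / 2) / Real.sqrt d := by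
    refine div_le_div_of_nonneg_right ?_ (by positivity)
    linarith
  have hQd : Q / 2 / Real.sqrt d ≤ (1 + ε) * Q :=
    (div_le_self (by positivity) hsd).trans (by nlinarith)
  rw [hqq, sub_div, sub_div] at hmono2
  have e1 : q * (2 / Real.sqrt d) = 2 * (q / Real.sqrt d) := by ring
  have e2 : 1 / 2 * (M / Real.sqrt d) = M / 2 / Real.sqrt d := by ring
  rw [e2]
  linarith

theorem le_integral_limitKernel {d : ℕ} (hd : 0 < d) {ε : ℝ} (hε : ε ∈ Set.Ioo (0 : ℝ) 1)
    (a b : E d) :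
    1 - 1 / Real.sqrt (2 * Real.pi * d) * ‖a - b‖ + ε - delta₂ d ε ≤
      ∫ v, limitKernel ε a b v ∂(gaussianLaw d) := by
  have h0 := hε.1
  have hQ := (measureReal_gaussianLaw_reject_le hd h0).trans (exp_mul_one_add_rpow_le hε d)
  have hpos : 0 ≤ ∫ v in {v : E d | 1 + ε ≤ ‖v‖ ^ 2}, |inner ℝ v (a - b)| ∂(gaussianLaw d) :=
    integral_nonneg fun _ => abs_nonneg _
  have hF : 0 ≤ Real.exp (-(d * ε ^ 2 / 16)) / Real.sqrt d := by positivity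
  rw [integral_limitKernel_eq, delta₂]
  nlinarith [mul_le_mul_of_nonneg_left hQ (show 0 ≤ 1 + ε by linarith)]

/-! ### Discretization of the threshold -/

/-- The Riemann sum over the thresholds `s k / n`, `-n ≤ k ≤ n`, of the indicator of `c ≤ τ`
exceeds its integral over `[-s, s]` by at most one step. -/
theorem riemannSum_threshold_mem_Icc {s c : ℝ} (hc : |c| < s) {n : ℕ} (hn : 0 < n) :
    s / n * ∑ k : Finset.Icc (-(n : ℤ)) (n : ℤ), (if c ≤ s * (k : ℤ) / n then (1 : ℝ) else 0) ∈
      Set.Icc (s - c) (s - c + s / n) := by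
  have hs : 0 < s := (abs_nonneg c).trans_lt hc
  have hn' : (0 : ℝ) < n := by exact_mod_cast hn
  obtain ⟨hc1, hc2⟩ := abs_lt.1 hc
  -- the thresholds that count are those with `z ≤ k ≤ n`
  set z : ℤ := ⌈c * n / s⌉ with hz
  have hiff : ∀ k : ℤ, c ≤ s * k / n ↔ z ≤ k := fun k => by
    rw [hz, Int.ceil_le, le_div_iff₀ hn', div_le_iff₀ hs, mul_comm s]
  have hz1 : -(n : ℤ) ≤ z := by
    have : ((-(n : ℤ) : ℤ) : ℝ) ≤ (z : ℝ) := by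
      refine le_trans ?_ (Int.le_ceil _)
      rw [le_div_iff₀ hs]
      push_cast
      nlinarith
    exact_mod_cast this
  have hz2 : z ≤ n := by
    rw [hz, Int.ceil_le, div_le_iff₀ hs]
    push_cast
    nlinarith
  have hsum : ∑ k : Finset.Icc (-(n : ℤ)) (n : ℤ),
      (if c ≤ s * (k : ℤ) / n then (1 : ℝ) else 0) = n + 1 - z := by
    rw [Finset.sum_coe_sort (Finset.Icc (-(n : ℤ)) (n : ℤ))
      (fun k : ℤ => if c ≤ s * k / n then (1 : ℝ) else 0)]
    simp_rw [hiff]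
    rw [← Finset.sum_filter, Finset.sum_const, nsmul_eq_mul, mul_one]
    have : (Finset.Icc (-(n : ℤ)) (n : ℤ)).filter (fun k => z ≤ k) = Finset.Icc z n := by
      ext k
      simp only [Finset.mem_filter, Finset.mem_Icc]
      omega
    rw [this, Int.card_Icc]
    have h3 : (((n : ℤ) + 1 - z).toNat : ℤ) = n + 1 - z := Int.toNat_of_nonneg (by omega)
    have h4 : ((((n : ℤ) + 1 - z).toNat : ℤ) : ℝ) = ((n + 1 - z : ℤ) : ℝ) := by rw [h3]
    push_cast at h4
    exact h4
  rw [hsum]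
  have hle : c * n / s ≤ z := Int.le_ceil _
  have hlt : (z : ℝ) < c * n / s + 1 := Int.ceil_lt_add_one _
  have e : s / n * (c * n / s) = c := by field_simp
  have e2 : s / n * n = s := by field_simp
  have hsn : 0 < s / n := by positivity
  constructor <;> nlinarith

/-! ### Expectation of the template kernel and the orbit distance -/

/-- The indicator of `⟨g v, x⟩ ≤ τ` for the template drawn from `v`, as a function of `(g, v)`;
the group element is moved to the side of `x`. -/
noncomputable def acceptedIndicator {d : ℕ} {G : Type*} [Group G] (ε : ℝ)
    (ρ : G →* (E d ≃ₗᵢ[ℝ] E d)) (x : E d) (τ : ℝ) (g : G) (v : E d) : ℝ :=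
  open Classical in if ‖v‖ ^ 2 < 1 + ε ∧ inner ℝ v (ρ g⁻¹ x) ≤ τ then 1 else 0

/-- The probability over `g` that the template drawn from `v` is accepted and `⟨g v, x⟩ ≤ τ`. -/
noncomputable def templateCdf {d : ℕ} {G : Type*} [Group G] [MeasurableSpace G] (ε : ℝ)
    (ρ : G →* (E d ≃ₗᵢ[ℝ] E d)) (μ : Measure G) (x : E d) (τ : ℝ) (v : E d) : ℝ :=
  ∫ g, acceptedIndicator ε ρ x τ g v ∂μ

/-- The contribution of one template to `⟨Φ(x), Φ(z)⟩` when the empirical distribution functions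
are replaced by the exact ones. -/
noncomputable def templateKernel {d : ℕ} {G : Type*} [Group G] [MeasurableSpace G] (ε : ℝ)
    (ρ : G →* (E d ≃ₗᵢ[ℝ] E d)) (μ : Measure G) (n : ℕ) (x z v : E d) : ℝ :=
  (1 + ε) / n * ∑ k : Finset.Icc (-(n : ℤ)) (n : ℤ),
    templateCdf ε ρ μ x ((1 + ε) * (k : ℤ) / n) v * templateCdf ε ρ μ z ((1 + ε) * (k : ℤ) / n) v

section Algebra

variable {d : ℕ} {G : Type*} [Group G] (ε : ℝ) (ρ : G →* (E d ≃ₗᵢ[ℝ] E d))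

theorem map_apply_map_apply (g h : G) (v : E d) : ρ g (ρ h v) = ρ (g * h) v := by
  rw [map_mul]; rfl

theorem inner_map_left (g : G) (v x : E d) : (inner ℝ (ρ g v) x : ℝ) = inner ℝ v (ρ g⁻¹ x) := by
  rw [← (ρ g⁻¹).inner_map_map (ρ g v) x, map_apply_map_apply, inv_mul_cancel, map_one]
  rfl

theorem cdfIndicator_template (x : E d) (τ : ℝ) (g : G) (v : E d) :
    cdfIndicator ρ g (template ε v) x τ = acceptedIndicator ε ρ x τ g v := by
  unfold cdfIndicator template acceptedIndicator
  by_cases hv : ‖v‖ ^ 2 < 1 + ε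
  · simp [hv, inner_map_left]
  · simp [hv]

theorem acceptedIndicator_mem_Icc (x : E d) (τ : ℝ) (g : G) (v : E d) :
    acceptedIndicator ε ρ x τ g v ∈ Set.Icc (0 : ℝ) 1 := by
  unfold acceptedIndicator
  split_ifs <;> simp

/-- For fixed group elements, the Riemann sum of the product of the two indicators is the
limiting kernel up to one step. -/
theorem riemannSum_acceptedIndicator_mem_Icc (hε : 0 < ε) {n : ℕ} (hn : 0 < n)
    {x z : E d} (hx : ‖x‖ = 1) (hz : ‖z‖ = 1) (g g' : G) (v : E d) :
    (1 + ε) / n * ∑ k : Finset.Icc (-(n : ℤ)) (n : ℤ),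
      acceptedIndicator ε ρ x ((1 + ε) * (k : ℤ) / n) g v *
        acceptedIndicator ε ρ z ((1 + ε) * (k : ℤ) / n) g' v ∈
      Set.Icc (limitKernel ε (ρ g⁻¹ x) (ρ g'⁻¹ z) v)
        (limitKernel ε (ρ g⁻¹ x) (ρ g'⁻¹ z) v + (1 + ε) / n) := by
  by_cases hv : ‖v‖ ^ 2 < 1 + ε
  · have hlt : ‖v‖ < 1 + ε := by nlinarith [norm_nonneg v]
    have hb : ∀ (g : G) {x : E d}, ‖x‖ = 1 → |(inner ℝ v (ρ g⁻¹ x) : ℝ)| < 1 + ε :=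
      fun g x hx => by
        refine (abs_real_inner_le_norm _ _).trans_lt ?_
        rwa [LinearIsometryEquiv.norm_map, hx, mul_one]
    have hc : |max (inner ℝ v (ρ g⁻¹ x) : ℝ) (inner ℝ v (ρ g'⁻¹ z))| < 1 + ε := by
      rcases max_choice (inner ℝ v (ρ g⁻¹ x) : ℝ) (inner ℝ v (ρ g'⁻¹ z)) with h | h <;> rw [h]
      exacts [hb g hx, hb g' hz]
    have h := riemannSum_threshold_mem_Icc hc hn
    simp only [limitKernel, Set.indicator, Set.mem_ofPred_eq, hv, if_true]
    convert h using 4 with k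
    by_cases h1 : (inner ℝ v (ρ g⁻¹ x) : ℝ) ≤ (1 + ε) * (k : ℤ) / n <;>
      by_cases h2 : (inner ℝ v (ρ g'⁻¹ z) : ℝ) ≤ (1 + ε) * (k : ℤ) / n <;>
      simp [-map_inv, acceptedIndicator, hv, h1, h2]
  · have : 0 ≤ (1 + ε) / (n : ℝ) := by positivity
    simpa [acceptedIndicator, limitKernel, Set.indicator, hv] using this

end Algebra

section Haar

variable {G : Type*} [Group G] [MeasurableSpace G] [MeasurableMul G] (μ : Measure G)
  [IsProbabilityMeasure μ] [μ.IsMulLeftInvariant]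

/-- A left invariant probability measure is invariant under inversion. The joint integrability
replaces the measurability of the group multiplication on the product σ-algebra, which may fail
when the topology has no countable base. -/
theorem integral_comp_inv_eq (h : G → ℝ)
    (hint : Integrable (fun p : G × G => h (p.1⁻¹ * p.2)) (μ.prod μ)) :
    ∫ g, h g⁻¹ ∂μ = ∫ g, h g ∂μ := by
  have hswap := integral_integral_swap (f := fun g' g : G => h (g'⁻¹ * g)) hint
  have h1 : ∀ g', ∫ g, h (g'⁻¹ * g) ∂μ = ∫ g, h g ∂μ := fun g' =>
    integral_mul_left_eq_self h g'⁻¹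
  have h2 : ∀ g, ∫ g', h (g'⁻¹ * g) ∂μ = ∫ g', h g'⁻¹ ∂μ := fun g => by
    rw [← integral_mul_left_eq_self (fun g' => h g'⁻¹) g⁻¹]
    simp
  simp_rw [h1, h2] at hswap
  simpa using hswap.symm

end Haar

section Measure

variable {d : ℕ} {G : Type*} [Group G] [MeasurableSpace G] (μ : Measure G)
  [IsProbabilityMeasure μ] (ε : ℝ) {ρ : G →* (E d ≃ₗᵢ[ℝ] E d)}

theorem integrable_norm_map_sub_map (hρ : ∀ v : E d, Measurable fun g : G => ρ g v) (x z : E d) :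
    Integrable (fun p : G × G => ‖ρ p.1 x - ρ p.2 z‖) (μ.prod μ) := by
  have h1 := hρ x
  have h2 := hρ z
  refine Integrable.of_bound (by fun_prop) (‖x‖ + ‖z‖)
    (Filter.Eventually.of_forall fun p => ?_)
  rw [norm_norm]
  refine (norm_sub_le _ _).trans ?_
  simp

theorem integral_norm_sub_map_inv [MeasurableMul G] [μ.IsMulLeftInvariant]
    (hρ : ∀ v : E d, Measurable fun g : G => ρ g v) (x z : E d) :
    ∫ g, ‖x - ρ g⁻¹ z‖ ∂μ = ∫ g, ‖x - ρ g z‖ ∂μ := by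
  refine integral_comp_inv_eq μ (fun g => ‖x - ρ g z‖) ?_
  convert integrable_norm_map_sub_map μ hρ x z using 2 with p
  rw [← (ρ p.1).norm_map (x - ρ (p.1⁻¹ * p.2) z), map_sub, map_apply_map_apply,
    mul_inv_cancel_left]

/-- The orbit distance, with the inverse group elements that come from moving `g` to the other side
of the inner product. -/
theorem integral_norm_map_inv_sub_map_inv [MeasurableMul G] [MeasurableInv G]
    [μ.IsMulLeftInvariant] (hρ : ∀ v : E d, Measurable fun g : G => ρ g v) (x z : E d) :
    1 / Real.sqrt (2 * Real.pi * d) * ∫ p, ‖ρ p.1⁻¹ x - ρ p.2⁻¹ z‖ ∂(μ.prod μ) =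
      orbitDist ρ μ x z := by
  have hinv : ∀ v : E d, Measurable fun g : G => ρ g⁻¹ v := fun v => (hρ v).comp measurable_inv
  have hx := hinv x
  have hz := hinv z
  have hx' := hρ x
  have hz' := hρ z
  have hb : ∀ a b : G, ‖‖ρ a x - ρ b z‖‖ ≤ ‖x‖ + ‖z‖ := fun a b => by
    rw [norm_norm]
    refine (norm_sub_le _ _).trans ?_
    simp
  have hi1 : Integrable (fun p : G × G => ‖ρ p.1⁻¹ x - ρ p.2⁻¹ z‖) (μ.prod μ) :=
    Integrable.of_bound (by fun_prop) (‖x‖ + ‖z‖)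
      (Filter.Eventually.of_forall fun p => hb _ _)
  have hi2 : Integrable (fun p : G × G => ‖ρ p.1⁻¹ x - ρ p.2 z‖) (μ.prod μ) :=
    Integrable.of_bound (by fun_prop) (‖x‖ + ‖z‖)
      (Filter.Eventually.of_forall fun p => hb _ _)
  unfold orbitDist
  congr 1
  rw [integral_prod _ hi1]
  simp_rw [integral_norm_sub_map_inv μ hρ]
  rw [integral_integral_swap hi2]
  simp_rw [norm_sub_rev (ρ _ x), integral_norm_sub_map_inv μ hρ]

theorem measurable_acceptedIndicator (hρ : ∀ v : E d, Measurable fun g : G => ρ g⁻¹ v)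
    (x : E d) (τ : ℝ) : Measurable fun p : G × E d => acceptedIndicator ε ρ x τ p.1 p.2 := by
  have h := hρ x
  have h1 : MeasurableSet {p : G × E d | ‖p.2‖ ^ 2 < 1 + ε} :=
    measurableSet_lt (by fun_prop) measurable_const
  have h2 : MeasurableSet {p : G × E d | inner ℝ p.2 (ρ p.1⁻¹ x) ≤ τ} :=
    measurableSet_le (measurable_snd.inner (h.comp measurable_fst)) measurable_const
  exact Measurable.ite (h1.inter h2) measurable_const measurable_const

theorem measurable_templateCdf (hρ : ∀ v : E d, Measurable fun g : G => ρ g⁻¹ v)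
    (x : E d) (τ : ℝ) : Measurable (templateCdf ε ρ μ x τ) :=
  (StronglyMeasurable.integral_prod_right'
    (f := fun q : E d × G => acceptedIndicator ε ρ x τ q.2 q.1)
    ((measurable_acceptedIndicator ε hρ x τ).comp measurable_swap).stronglyMeasurable).measurable

theorem templateCdf_mem_Icc (ρ : G →* (E d ≃ₗᵢ[ℝ] E d)) (x : E d) (τ : ℝ) (v : E d) :
    templateCdf ε ρ μ x τ v ∈ Set.Icc (0 : ℝ) 1 := by
  refine ⟨integral_nonneg fun g => (acceptedIndicator_mem_Icc ε ρ x τ g v).1, ?_⟩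
  calc templateCdf ε ρ μ x τ v ≤ ∫ _, (1 : ℝ) ∂μ :=
        integral_mono_of_nonneg
          (Filter.Eventually.of_forall fun g => (acceptedIndicator_mem_Icc ε ρ x τ g v).1)
          (integrable_const _)
          (Filter.Eventually.of_forall fun g => (acceptedIndicator_mem_Icc ε ρ x τ g v).2)
    _ = 1 := by simp

theorem measurable_templateKernel (hρ : ∀ v : E d, Measurable fun g : G => ρ g⁻¹ v)
    (n : ℕ) (x z : E d) : Measurable (templateKernel ε ρ μ n x z) := by
  have := measurable_templateCdf μ ε hρ
  unfold templateKernel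
  fun_prop

theorem card_thresholds (n : ℕ) :
    (Fintype.card (Finset.Icc (-(n : ℤ)) (n : ℤ)) : ℝ) = 2 * n + 1 := by
  rw [Fintype.card_coe, Int.card_Icc]
  have h : ((n : ℤ) + 1 - -(n : ℤ)).toNat = 2 * n + 1 := by omega
  rw [h]
  push_cast
  ring

theorem sum_thresholds_le {n : ℕ} {f : Finset.Icc (-(n : ℤ)) (n : ℤ) → ℝ} (hf : ∀ k, f k ≤ 1) :
    ∑ k, f k ≤ 2 * n + 1 := by
  rw [← card_thresholds]
  simpa using Finset.sum_le_sum fun k (_ : k ∈ Finset.univ) => hf k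

/-- The step of the discretization times the number of thresholds. -/
theorem step_mul_card_le {ε : ℝ} (hε : ε ∈ Set.Ioo (0 : ℝ) 1) {n : ℕ} (hn : 0 < n) :
    (1 + ε) / n * (2 * n + 1) ≤ 6 := by
  have hn1 : (1 : ℝ) ≤ n := by exact_mod_cast hn
  rw [div_mul_eq_mul_div, div_le_iff₀ (by linarith)]
  nlinarith [hε.1, hε.2]

theorem templateKernel_mem_Icc {ε : ℝ} (hε : ε ∈ Set.Ioo (0 : ℝ) 1)
    (ρ : G →* (E d ≃ₗᵢ[ℝ] E d)) {n : ℕ} (hn : 0 < n) (x z v : E d) :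
    templateKernel ε ρ μ n x z v ∈ Set.Icc (0 : ℝ) 6 := by
  have h0 := hε.1
  have hc := templateCdf_mem_Icc μ ε ρ
  refine ⟨mul_nonneg (by positivity)
    (Finset.sum_nonneg fun k _ => mul_nonneg (hc _ _ _).1 (hc _ _ _).1), ?_⟩
  refine le_trans ?_ (step_mul_card_le hε hn)
  unfold templateKernel
  gcongr
  exact sum_thresholds_le fun k => mul_le_one₀ (hc _ _ _).2 (hc _ _ _).1 (hc _ _ _).2

/-- Fubini: the expectation of the template kernel, with the group elements outside. -/
theorem integral_templateKernel_eq (hρ : ∀ v : E d, Measurable fun g : G => ρ g⁻¹ v)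
    (n : ℕ) (x z : E d) :
    ∫ v, templateKernel ε ρ μ n x z v ∂(gaussianLaw d) =
      ∫ p, ∫ v, (1 + ε) / n * ∑ k : Finset.Icc (-(n : ℤ)) (n : ℤ),
        acceptedIndicator ε ρ x ((1 + ε) * (k : ℤ) / n) p.1 v *
          acceptedIndicator ε ρ z ((1 + ε) * (k : ℤ) / n) p.2 v ∂(gaussianLaw d) ∂(μ.prod μ) := by
  have hm : ∀ (y : E d) (τ : ℝ),
      Measurable fun p : G × E d => acceptedIndicator ε ρ y τ p.1 p.2 :=
    measurable_acceptedIndicator ε hρ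
  have hmk : ∀ (τ : ℝ), Measurable fun q : E d × (G × G) =>
      acceptedIndicator ε ρ x τ q.2.1 q.1 * acceptedIndicator ε ρ z τ q.2.2 q.1 := fun τ =>
    ((hm x τ).comp (f := fun q : E d × (G × G) => (q.2.1, q.1)) (by fun_prop)).mul
      ((hm z τ).comp (f := fun q : E d × (G × G) => (q.2.2, q.1)) (by fun_prop))
  have hbd : ∀ (τ : ℝ) (g g' : G) (v : E d),
      ‖acceptedIndicator ε ρ x τ g v * acceptedIndicator ε ρ z τ g' v‖ ≤ 1 := fun τ g g' v => by
    have h1 := acceptedIndicator_mem_Icc ε ρ x τ g v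
    have h2 := acceptedIndicator_mem_Icc ε ρ z τ g' v
    rw [Real.norm_of_nonneg (mul_nonneg h1.1 h2.1)]
    exact mul_le_one₀ h1.2 h2.1 h2.2
  have hik : ∀ τ : ℝ, Integrable (fun q : E d × (G × G) =>
      acceptedIndicator ε ρ x τ q.2.1 q.1 * acceptedIndicator ε ρ z τ q.2.2 q.1)
      ((gaussianLaw d).prod (μ.prod μ)) := fun τ =>
    Integrable.of_bound (hmk τ).aestronglyMeasurable 1
      (Filter.Eventually.of_forall fun q => hbd _ _ _ _)
  have hint : Integrable (Function.uncurry fun (v : E d) (p : G × G) =>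
      (1 + ε) / n * ∑ k : Finset.Icc (-(n : ℤ)) (n : ℤ),
        acceptedIndicator ε ρ x ((1 + ε) * (k : ℤ) / n) p.1 v *
          acceptedIndicator ε ρ z ((1 + ε) * (k : ℤ) / n) p.2 v)
      ((gaussianLaw d).prod (μ.prod μ)) :=
    (integrable_finsetSum _ fun k _ => hik _).const_mul _
  rw [← integral_integral_swap hint]
  refine integral_congr_ae (Filter.Eventually.of_forall fun v => ?_)
  beta_reduce
  rw [integral_const_mul, integral_finsetSum]
  · unfold templateKernel
    congr 1
    exact Finset.sum_congr rfl fun k _ => (integral_prod_mul (μ := μ) (ν := μ)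
      (fun g => acceptedIndicator ε ρ x ((1 + ε) * (k : ℤ) / n) g v)
      (fun g => acceptedIndicator ε ρ z ((1 + ε) * (k : ℤ) / n) g v)).symm
  · intro k _
    exact Integrable.of_bound
      ((hmk ((1 + ε) * (k : ℤ) / n)).comp measurable_prodMk_left).aestronglyMeasurable 1
      (Filter.Eventually.of_forall fun q => hbd _ _ _ _)

/-- The expected template kernel is `1 - orbitDist` up to the rejection terms and one step of the
discretization. -/
theorem integral_templateKernel_mem_Icc [MeasurableMul G] [MeasurableInv G]
    [μ.IsMulLeftInvariant] (hρ : ∀ v : E d, Measurable fun g : G => ρ g v)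
    (hd : 0 < d) {ε : ℝ} (hε : ε ∈ Set.Ioo (0 : ℝ) 1) {n : ℕ} (hn : 0 < n)
    {x z : E d} (hx : ‖x‖ = 1) (hz : ‖z‖ = 1) :
    ∫ v, templateKernel ε ρ μ n x z v ∂(gaussianLaw d) ∈
      Set.Icc (1 - orbitDist ρ μ x z + ε - delta₂ d ε)
        (1 - orbitDist ρ μ x z + ε + delta₁ d ε + (1 + ε) / n) := by
  have hinv : ∀ v : E d, Measurable fun g : G => ρ g⁻¹ v := fun v => (hρ v).comp measurable_inv
  have hx' := hinv x
  have hz' := hinv z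
  have hnorm : ∀ (g : G) {y : E d}, ‖y‖ = 1 → ‖ρ g y‖ = 1 := fun g y hy => by
    rw [LinearIsometryEquiv.norm_map, hy]
  set D : G × G → E d → ℝ := fun p v =>
    (1 + ε) / n * ∑ k : Finset.Icc (-(n : ℤ)) (n : ℤ),
        acceptedIndicator ε ρ x ((1 + ε) * (k : ℤ) / n) p.1 v *
          acceptedIndicator ε ρ z ((1 + ε) * (k : ℤ) / n) p.2 v with hD
  have hDm : Measurable (Function.uncurry D) := by
    have hm : ∀ (y : E d) (τ : ℝ),
        Measurable fun p : G × E d => acceptedIndicator ε ρ y τ p.1 p.2 :=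
      measurable_acceptedIndicator ε hinv
    refine Measurable.const_mul (Finset.measurable_sum _ fun k _ => ?_) _
    exact ((hm x _).comp (f := fun q : (G × G) × E d => (q.1.1, q.2)) (by fun_prop)).mul
      ((hm z _).comp (f := fun q : (G × G) × E d => (q.1.2, q.2)) (by fun_prop))
  have hDmem : ∀ p v, D p v ∈ Set.Icc (limitKernel ε (ρ p.1⁻¹ x) (ρ p.2⁻¹ z) v)
        (limitKernel ε (ρ p.1⁻¹ x) (ρ p.2⁻¹ z) v + (1 + ε) / n) := fun p v =>
    riemannSum_acceptedIndicator_mem_Icc ε ρ hε.1 hn hx hz p.1 p.2 v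
  have hDb : ∀ p v, ‖D p v‖ ≤ 6 := fun p v => by
    have h0 := hε.1
    have hI := fun (y : E d) (τ : ℝ) (g : G) => acceptedIndicator_mem_Icc ε ρ y τ g v
    rw [Real.norm_of_nonneg (mul_nonneg (by positivity)
      (Finset.sum_nonneg fun k _ => mul_nonneg (hI _ _ _).1 (hI _ _ _).1))]
    refine le_trans ?_ (step_mul_card_le hε hn)
    gcongr
    exact sum_thresholds_le fun k => mul_le_one₀ (hI _ _ _).2 (hI _ _ _).1 (hI _ _ _).2
  have hDi : ∀ p, Integrable (D p) (gaussianLaw d) := fun p =>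
    Integrable.of_bound (hDm.comp measurable_prodMk_left).aestronglyMeasurable 6
      (Filter.Eventually.of_forall fun v => hDb p v)
  have hDDi : Integrable (fun p => ∫ v, D p v ∂(gaussianLaw d)) (μ.prod μ) :=
    (Integrable.of_bound (μ := (μ.prod μ).prod (gaussianLaw d)) hDm.aestronglyMeasurable 6
      (Filter.Eventually.of_forall fun q => hDb q.1 q.2)).integral_prod_left
  have hNi : Integrable (fun p : G × G => ‖ρ p.1⁻¹ x - ρ p.2⁻¹ z‖) (μ.prod μ) := by
    refine Integrable.of_bound (by fun_prop) 2 (Filter.Eventually.of_forall fun p => ?_)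
    rw [norm_norm]
    refine (norm_sub_le _ _).trans ?_
    rw [hnorm _ hx, hnorm _ hz]
    norm_num
  have hdist := integral_norm_map_inv_sub_map_inv μ hρ x z
  have haff : ∀ c : ℝ, ∫ p : G × G, (c - 1 / Real.sqrt (2 * Real.pi * d) *
      ‖ρ p.1⁻¹ x - ρ p.2⁻¹ z‖) ∂(μ.prod μ) = c - orbitDist ρ μ x z := fun c => by
    rw [integral_sub (integrable_const _) (hNi.const_mul _), integral_const_mul, hdist]
    simp
  have haffi : ∀ c : ℝ, Integrable (fun p : G × G => c - 1 / Real.sqrt (2 * Real.pi * d) *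
      ‖ρ p.1⁻¹ x - ρ p.2⁻¹ z‖) (μ.prod μ) := fun c =>
    (integrable_const _).sub (hNi.const_mul _)
  rw [integral_templateKernel_eq μ ε hinv]
  constructor
  · have := haff (1 + ε - delta₂ d ε)
    calc 1 - orbitDist ρ μ x z + ε - delta₂ d ε = _ := by rw [sub_add_eq_add_sub,
            sub_right_comm, ← this]
      _ ≤ ∫ p, ∫ v, D p v ∂(gaussianLaw d) ∂(μ.prod μ) := by
        refine integral_mono (haffi _) hDDi fun p => ?_
        have h1 := le_integral_limitKernel hd hε (ρ p.1⁻¹ x) (ρ p.2⁻¹ z)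
        have h2 := integral_mono (integrable_limitKernel ε (ρ p.1⁻¹ x) (ρ p.2⁻¹ z)) (hDi p)
          fun v => (hDmem p v).1
        linarith
  · have := haff (1 + ε + delta₁ d ε + (1 + ε) / n)
    calc ∫ p, ∫ v, D p v ∂(gaussianLaw d) ∂(μ.prod μ) ≤ _ := by
          refine integral_mono hDDi (haffi (1 + ε + delta₁ d ε + (1 + ε) / n)) fun p => ?_
          have h1 := integral_limitKernel_le hd hε (hnorm p.1⁻¹ hx) (hnorm p.2⁻¹ hz)
          have hi := integrable_limitKernel ε (ρ p.1⁻¹ x) (ρ p.2⁻¹ z)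
          have h2 := integral_mono (hDi p) (hi.add (integrable_const ((1 + ε) / (n : ℝ))))
            fun v => (hDmem p v).2
          simp only [Pi.add_apply] at h2
          rw [integral_add hi (integrable_const _)] at h2
          simp only [integral_const, probReal_univ, one_smul] at h2
          linarith
      _ = _ := by rw [this]; ring

end Measure

/-! ### Deviation of the feature map from the template kernel -/

/-- The empirical version of `templateCdf`, for the sampled group elements `g`. -/
noncomputable def empiricalCdf {d : ℕ} {G : Type*} [Group G] (ε : ℝ) (ρ : G →* (E d ≃ₗᵢ[ℝ] E d))
    {r : ℕ} (g : Fin r → G) (x : E d) (τ : ℝ) (v : E d) : ℝ :=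
  (∑ i, acceptedIndicator ε ρ x τ (g i) v) / r

/-- The deviation of the empirical distribution functions from the exact ones, averaged over all
templates and all thresholds. -/
noncomputable def cdfDeviation {d : ℕ} {G : Type*} [Group G] [MeasurableSpace G] (ε : ℝ)
    (ρ : G →* (E d ≃ₗᵢ[ℝ] E d)) (μ : Measure G) (n : ℕ) {m r : ℕ} (x : E d) (v : Fin m → E d)
    (g : Fin r → G) : ℝ :=
  (∑ p : Fin m × Finset.Icc (-(n : ℤ)) (n : ℤ),
    |empiricalCdf ε ρ g x ((1 + ε) * (p.2 : ℤ) / n) (v p.1) -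
      templateCdf ε ρ μ x ((1 + ε) * (p.2 : ℤ) / n) (v p.1)|) /
    Fintype.card (Fin m × Finset.Icc (-(n : ℤ)) (n : ℤ))

section Algebra

variable {d : ℕ} {G : Type*} [Group G] {ε : ℝ} (ρ : G →* (E d ≃ₗᵢ[ℝ] E d))

theorem empiricalCdf_mem_Icc {r : ℕ} (g : Fin r → G) (x : E d) (τ : ℝ) (v : E d) :
    empiricalCdf ε ρ g x τ v ∈ Set.Icc (0 : ℝ) 1 := by
  have h := fun i => acceptedIndicator_mem_Icc ε ρ x τ (g i) v
  refine ⟨div_nonneg (Finset.sum_nonneg fun i _ => (h i).1) (Nat.cast_nonneg _), ?_⟩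
  refine div_le_one_of_le₀ ?_ (Nat.cast_nonneg _)
  simpa using Finset.sum_le_sum fun i (_ : i ∈ Finset.univ) => (h i).2

theorem inner_featureMap (hε : 0 ≤ 1 + ε) (n : ℕ) {m r : ℕ} (v : Fin m → E d) (g : Fin r → G)
    (x z : E d) :
    (inner ℝ (featureMap ρ (1 + ε) n (fun l => template ε (v l)) g x)
      (featureMap ρ (1 + ε) n (fun l => template ε (v l)) g z) : ℝ) =
      (1 + ε) / (n * m) * ∑ p : Fin m × Finset.Icc (-(n : ℤ)) (n : ℤ),
        empiricalCdf ε ρ g x ((1 + ε) * (p.2 : ℤ) / n) (v p.1) *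
          empiricalCdf ε ρ g z ((1 + ε) * (p.2 : ℤ) / n) (v p.1) := by
  rw [PiLp.inner_apply, Finset.mul_sum]
  refine Finset.sum_congr rfl fun p _ => ?_
  simp only [featureMap, featureEntry, cdfIndicator_template, empiricalCdf, RCLike.inner_apply,
    conj_trivial]
  have h1 := Real.mul_self_sqrt hε
  have h2 := Real.mul_self_sqrt (show (0 : ℝ) ≤ n * m by positivity)
  rw [show (1 + ε) / ((n : ℝ) * m) = (Real.sqrt (1 + ε) * Real.sqrt (1 + ε)) /
    (Real.sqrt ((n : ℝ) * m) * Real.sqrt ((n : ℝ) * m)) by rw [h1, h2]]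
  ring

theorem abs_mul_sub_mul_le {a b c e : ℝ} (ha : a ∈ Set.Icc (0 : ℝ) 1)
    (he : e ∈ Set.Icc (0 : ℝ) 1) :
    |a * b - c * e| ≤ |a - c| + |b - e| := by
  calc |a * b - c * e| = |a * (b - e) + (a - c) * e| := by ring_nf
    _ ≤ |a * (b - e)| + |(a - c) * e| := abs_add_le _ _
    _ ≤ |a - c| + |b - e| := by
      rw [abs_mul, abs_mul, abs_of_nonneg ha.1, abs_of_nonneg he.1]
      nlinarith [mul_le_of_le_one_left (abs_nonneg (b - e)) ha.2,
        mul_le_of_le_one_right (abs_nonneg (a - c)) he.2]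

/-- Replacing the empirical distribution functions by the exact ones changes the inner product by at
most a constant times the averaged deviations. -/
theorem abs_inner_featureMap_sub_le [MeasurableSpace G] (μ : Measure G) [IsProbabilityMeasure μ]
    (hε : ε ∈ Set.Ioo (0 : ℝ) 1) {n : ℕ} (hn : 0 < n) {m r : ℕ} (hm : 0 < m)
    (v : Fin m → E d) (g : Fin r → G) (x z : E d) :
    |(inner ℝ (featureMap ρ (1 + ε) n (fun l => template ε (v l)) g x)
      (featureMap ρ (1 + ε) n (fun l => template ε (v l)) g z) : ℝ) -
      (∑ l, templateKernel ε ρ μ n x z (v l)) / m| ≤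
      6 * (cdfDeviation ε ρ μ n x v g + cdfDeviation ε ρ μ n z v g) := by
  have h0 := hε.1
  have hm' : (0 : ℝ) < m := by exact_mod_cast hm
  have hn' : (0 : ℝ) < n := by exact_mod_cast hn
  have hcard : (Fintype.card (Fin m × Finset.Icc (-(n : ℤ)) (n : ℤ)) : ℝ) = m * (2 * n + 1) := by
    rw [Fintype.card_prod, Fintype.card_fin, Nat.cast_mul, card_thresholds]
  set e : E d → Fin m × Finset.Icc (-(n : ℤ)) (n : ℤ) → ℝ := fun y p =>
    empiricalCdf ε ρ g y ((1 + ε) * (p.2 : ℤ) / n) (v p.1)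
  set q : E d → Fin m × Finset.Icc (-(n : ℤ)) (n : ℤ) → ℝ := fun y p =>
    templateCdf ε ρ μ y ((1 + ε) * (p.2 : ℤ) / n) (v p.1)
  have hker : (∑ l, templateKernel ε ρ μ n x z (v l)) / m =
      (1 + ε) / (n * m) * ∑ p, q x p * q z p := by
    rw [Fintype.sum_prod_type]
    simp only [templateKernel, ← Finset.mul_sum, q]
    ring
  have hdev : ∀ y, ∑ p, |e y p - q y p| = m * (2 * n + 1) * cdfDeviation ε ρ μ n y v g :=
      fun y => by
    rw [cdfDeviation, hcard]
    field_simp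
    rfl
  rw [inner_featureMap ρ (by linarith), hker, ← mul_sub, ← Finset.sum_sub_distrib, abs_mul,
    abs_of_nonneg (by positivity)]
  have hA : 0 ≤ cdfDeviation ε ρ μ n x v g + cdfDeviation ε ρ μ n z v g := by
    unfold cdfDeviation; positivity
  calc (1 + ε) / (n * m) * |∑ p, (e x p * e z p - q x p * q z p)|
      ≤ (1 + ε) / (n * m) * ∑ p, (|e x p - q x p| + |e z p - q z p|) := by
        gcongr
        refine (Finset.abs_sum_le_sum_abs _ _).trans (Finset.sum_le_sum fun p _ => ?_)
        exact abs_mul_sub_mul_le (empiricalCdf_mem_Icc ρ _ _ _ _)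
          (templateCdf_mem_Icc μ ε ρ _ _ _)
    _ = (1 + ε) / n * (2 * n + 1) *
          (cdfDeviation ε ρ μ n x v g + cdfDeviation ε ρ μ n z v g) := by
        rw [Finset.sum_add_distrib, hdev, hdev]
        field_simp
    _ ≤ _ := by
        gcongr
        exact step_mul_card_le hε hn

end Algebra

section Measure

variable {d : ℕ} {G : Type*} [Group G] [MeasurableSpace G] (μ : Measure G)
  [IsProbabilityMeasure μ] {ε : ℝ} {ρ : G →* (E d ≃ₗᵢ[ℝ] E d)}

instance isProbabilityMeasure_sampleLaw (d m r : ℕ) :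
    IsProbabilityMeasure (sampleLaw d m r μ) := by
  unfold sampleLaw; infer_instance

theorem measureReal_prod_le_of_forall_section_le {α β : Type*} [MeasurableSpace α]
    [MeasurableSpace β] {P : Measure α} {P' : Measure β} [IsProbabilityMeasure P]
    [IsProbabilityMeasure P'] {S : Set (α × β)} (hS : MeasurableSet S) {c : ℝ} (hc : 0 ≤ c)
    (h : ∀ a, P'.real (Prod.mk a ⁻¹' S) ≤ c) : (P.prod P').real S ≤ c := by
  refine ENNReal.toReal_le_of_le_ofReal hc ?_
  rw [Measure.prod_apply hS]
  calc ∫⁻ a, P' (Prod.mk a ⁻¹' S) ∂P ≤ ∫⁻ _, ENNReal.ofReal c ∂P :=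
        lintegral_mono fun a => (ENNReal.le_ofReal_iff_toReal_le (measure_ne_top _ _) hc).2 (h a)
    _ = ENNReal.ofReal c := by simp

/-- Conditionally on the templates, the sampled group elements satisfy the concentration bound. -/
theorem measureReal_cdfDeviation_ge_le (hρ : ∀ v : E d, Measurable fun g : G => ρ g⁻¹ v)
    {n m r : ℕ} (hm : 0 < m) (hr : 0 < r) (x : E d) {t : ℝ} (ht : 0 ≤ t) :
    (sampleLaw d m r μ).real {ω | t ≤ cdfDeviation ε ρ μ n x ω.1 ω.2} ≤
      2 * Real.exp (-(2 * r * t ^ 2)) := by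
  have hI : ∀ τ : ℝ, Measurable fun p : G × E d => acceptedIndicator ε ρ x τ p.1 p.2 :=
    measurable_acceptedIndicator ε hρ x
  have hq := measurable_templateCdf μ ε hρ x
  have : Nonempty (Fin m × Finset.Icc (-(n : ℤ)) (n : ℤ)) :=
    ⟨⟨⟨0, hm⟩, ⟨0, by simp⟩⟩⟩
  unfold sampleLaw
  refine measureReal_prod_le_of_forall_section_le ?_ (by positivity) fun v => ?_
  · refine measurableSet_le measurable_const ?_
    unfold cdfDeviation empiricalCdf
    refine (Finset.measurable_sum _ fun p _ => ?_).div_const _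
    have h1 : ∀ i : Fin r, Measurable fun ω : (Fin m → E d) × (Fin r → G) =>
        acceptedIndicator ε ρ x ((1 + ε) * (p.2 : ℤ) / n) (ω.2 i) (ω.1 p.1) := fun i =>
      (hI _).comp (f := fun ω : (Fin m → E d) × (Fin r → G) => (ω.2 i, ω.1 p.1)) (by fun_prop)
    have h2 : Measurable fun ω : (Fin m → E d) × (Fin r → G) =>
        templateCdf ε ρ μ x ((1 + ε) * (p.2 : ℤ) / n) (ω.1 p.1) :=
      (hq _).comp (f := fun ω : (Fin m → E d) × (Fin r → G) => ω.1 p.1) (by fun_prop)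
    exact (((Finset.measurable_sum _ fun i _ => h1 i).div_const _).sub h2).abs
  · exact measureReal_average_abs_sampleMean_sub_ge_le μ
      (f := fun (p : Fin m × Finset.Icc (-(n : ℤ)) (n : ℤ)) (g : G) =>
        acceptedIndicator ε ρ x ((1 + ε) * (p.2 : ℤ) / n) g (v p.1))
      (fun p => (hI _).comp (f := fun g : G => (g, v p.1)) (by fun_prop))
      (fun p g => acceptedIndicator_mem_Icc _ _ _ _ _ _) hr ht

/-- Hoeffding's inequality for the average of the template kernels, which lie in `[0, 6]`. -/
theorem measureReal_templateKernel_deviation_ge_le (hε : ε ∈ Set.Ioo (0 : ℝ) 1)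
    (hρ : ∀ v : E d, Measurable fun g : G => ρ g⁻¹ v)
    {n m r : ℕ} (hn : 0 < n) (hm : 0 < m) (x z : E d) {t : ℝ} (ht : 0 ≤ t) :
    (sampleLaw d m r μ).real {ω | 6 * t ≤ |(∑ l, templateKernel ε ρ μ n x z (ω.1 l)) / m -
      ∫ v, templateKernel ε ρ μ n x z v ∂(gaussianLaw d)|} ≤
      2 * Real.exp (-(2 * m * t ^ 2)) := by
  have hW := measurable_templateKernel μ ε hρ n x z
  have hWb := templateKernel_mem_Icc μ hε ρ hn x z
  have h := measureReal_average_abs_sampleMean_sub_ge_le (gaussianLaw d) (K := Unit)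
    (f := fun _ v => templateKernel ε ρ μ n x z v / 6) (fun _ => hW.div_const 6)
    (fun _ v => ⟨div_nonneg (hWb v).1 (by norm_num), by
      rw [div_le_one (by norm_num)]; exact (hWb v).2⟩) hm ht
  have hset : {ω : (Fin m → E d) × (Fin r → G) |
      6 * t ≤ |(∑ l, templateKernel ε ρ μ n x z (ω.1 l)) / m -
        ∫ v, templateKernel ε ρ μ n x z v ∂(gaussianLaw d)|} =
      Prod.fst ⁻¹' {w : Fin m → E d | t ≤ (∑ _k : Unit,
        |(∑ i, templateKernel ε ρ μ n x z (w i) / 6) / m -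
          ∫ v, templateKernel ε ρ μ n x z v / 6 ∂(gaussianLaw d)|) / Fintype.card Unit} := by
    ext ω
    simp only [Set.mem_ofPred_eq, Set.mem_preimage, Finset.univ_unique, Finset.sum_const,
      Finset.card_singleton, one_smul, Fintype.card_unit, Nat.cast_one, div_one]
    rw [← Finset.sum_div, integral_div, div_right_comm, ← sub_div, abs_div,
      abs_of_pos (show (0 : ℝ) < 6 by norm_num), le_div_iff₀ (by norm_num), mul_comm]
  have hmeas : MeasurableSet {w : Fin m → E d | t ≤ (∑ _k : Unit,
        |(∑ i, templateKernel ε ρ μ n x z (w i) / 6) / m -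
          ∫ v, templateKernel ε ρ μ n x z v / 6 ∂(gaussianLaw d)|) / Fintype.card Unit} := by
    refine measurableSet_le measurable_const ?_
    fun_prop
  rw [hset, sampleLaw, measurePreserving_fst.measureReal_preimage hmeas.nullMeasurableSet]
  exact h

end Measure


/-! ### Union bound and conclusion -/

/-- An exponent of at least `(k + 1) log (N / δ)` pays for a union bound over `N ^ k` events; the
factor `2` is absorbed by a spare factor `δ < 1 / 2`. -/
theorem pow_mul_two_mul_exp_le {N : ℕ} (hN : 0 < N) {δ y : ℝ} (hδ : δ ∈ Set.Ioo (0 : ℝ) (1 / 2))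
    {k : ℕ} (hk : 1 ≤ k) (hy : (k + 1 : ℝ) * Real.log (N / δ) ≤ y) :
    (N : ℝ) ^ k * (2 * Real.exp (-y)) ≤ δ := by
  have hN1 : (1 : ℝ) ≤ N := by exact_mod_cast hN
  have h0 := hδ.1
  have hexp : Real.exp (-y) ≤ (δ / N) ^ (k + 1) := by
    calc Real.exp (-y) ≤ Real.exp (-((k + 1 : ℝ) * Real.log (N / δ))) := by
          rw [Real.exp_le_exp]; linarith
      _ = (δ / N) ^ (k + 1) := by
          rw [← mul_neg, ← Real.log_inv, inv_div]
          have : (k + 1 : ℝ) = ((k + 1 : ℕ) : ℝ) := by push_cast; ring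
          rw [this, Real.exp_nat_mul, Real.exp_log (by positivity)]
  calc (N : ℝ) ^ k * (2 * Real.exp (-y)) ≤ (N : ℝ) ^ k * (2 * (δ / N) ^ (k + 1)) := by gcongr
    _ = 2 * δ ^ k * (δ / N) := by
        rw [div_pow, pow_succ, pow_succ]
        field_simp
    _ ≤ 2 * δ ^ 1 * (δ / 1) := by
        have : δ ^ k ≤ δ ^ 1 := pow_le_pow_of_le_one h0.le (by linarith [hδ.2]) hk
        gcongr
    _ ≤ δ := by nlinarith [hδ.2]

end InvariantFeatures

theorem mainTheorem4 :
    ∃ C₁ C₂ : ℝ, 0 < C₁ ∧ 0 < C₂ ∧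
      ∀ (d : ℕ) (G : Type*) [Group G] [TopologicalSpace G] [IsTopologicalGroup G] [CompactSpace G]
        [MeasurableSpace G] [BorelSpace G]
        (μ : MeasureTheory.Measure G) [μ.IsHaarMeasure] [MeasureTheory.IsProbabilityMeasure μ]
        (ρ : G →* (InvariantFeatures.E d ≃ₗᵢ[ℝ] InvariantFeatures.E d))
        (_ : ∀ v : InvariantFeatures.E d, Continuous fun g : G => ρ g v)
        (ε ε₀ δ : ℝ) (_ : ε ∈ Set.Ioo (0 : ℝ) 1) (_ : ε₀ ∈ Set.Ioo (0 : ℝ) 1)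
        (_ : δ ∈ Set.Ioo (0 : ℝ) 1)
        (N : ℕ) (x : Fin N → InvariantFeatures.E d) (_ : ∀ i, ‖x i‖ = 1)
        (n m r : ℕ) (_ : 3 / ε₀ ≤ (n : ℝ))
        (_ : 9 * C₁ / ε₀ ^ 2 * Real.log ((N : ℝ) / δ) ≤ (m : ℝ))
        (_ : 9 * C₂ / ε₀ ^ 2 * Real.log ((N : ℝ) * m / δ) ≤ (r : ℝ)),
        1 - 2 * δ ≤
          (InvariantFeatures.sampleLaw d m r μ).real
            {ω | ∀ i j : Fin N,
              ε - InvariantFeatures.delta₂ d ε - ε₀ ≤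
                  inner ℝ
                      (InvariantFeatures.featureMap ρ (1 + ε) n
                        (fun l => InvariantFeatures.template ε (ω.1 l)) ω.2 (x i))
                      (InvariantFeatures.featureMap ρ (1 + ε) n
                        (fun l => InvariantFeatures.template ε (ω.1 l)) ω.2 (x j)) -
                    (1 - InvariantFeatures.orbitDist ρ μ (x i) (x j)) ∧
                inner ℝ
                      (InvariantFeatures.featureMap ρ (1 + ε) n
                        (fun l => InvariantFeatures.template ε (ω.1 l)) ω.2 (x i))
                      (InvariantFeatures.featureMap ρ (1 + ε) n
                        (fun l => InvariantFeatures.template ε (ω.1 l)) ω.2 (x j)) -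
                    (1 - InvariantFeatures.orbitDist ρ μ (x i) (x j)) ≤
                  ε₀ + ε + InvariantFeatures.delta₁ d ε} := by
  -- `216 = 3 * 72` makes the exponent `2 m (ε₀ / 36) ^ 2` at least `3 log (N / δ)`, and
  -- `576 = 2 * 288` makes `2 r (ε₀ / 72) ^ 2` at least `2 log (N / δ)`
  refine ⟨216, 576, by norm_num, by norm_num, ?_⟩
  intro d G _ _ _ _ _ _ μ _ _ ρ hρ ε ε₀ δ hε hε₀ hδ N x hx n m r hn hm hr
  rcases le_or_gt (1 / 2) δ with hδ2 | hδ2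
  · exact le_trans (by linarith) measureReal_nonneg
  have hd0 := hδ.1
  have he0 := hε.1
  have he0' := hε₀.1
  rcases Nat.eq_zero_or_pos N with rfl | hN
  · have : (InvariantFeatures.sampleLaw d m r μ).real Set.univ = 1 := probReal_univ
    rw [show {ω : (Fin m → InvariantFeatures.E d) × (Fin r → G) | ∀ i j : Fin 0, _} = Set.univ from
      Set.eq_univ_of_forall fun ω i => i.elim0, this]
    linarith
  have hd : 0 < d := by
    rcases Nat.eq_zero_or_pos d with rfl | hd
    · have h := hx ⟨0, hN⟩
      rw [Subsingleton.elim (x ⟨0, hN⟩) 0, norm_zero] at h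
      norm_num at h
    · exact hd
  have hN1 : (1 : ℝ) ≤ N := by exact_mod_cast hN
  have hL : 0 < Real.log (N / δ) := Real.log_pos (by
    rw [lt_div_iff₀ hd0]; linarith)
  have hm0 : 0 < m := by
    have : (0 : ℝ) < m := lt_of_lt_of_le (by positivity) hm
    exact_mod_cast this
  have hm1 : (1 : ℝ) ≤ m := by exact_mod_cast hm0
  have hLm : Real.log (N / δ) ≤ Real.log (N * m / δ) := by
    refine Real.log_le_log (by positivity) ?_
    gcongr
    nlinarith
  have hr2 : 9 * 576 / ε₀ ^ 2 * Real.log (N / δ) ≤ r :=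
    le_trans (by gcongr) hr
  have hr0 : 0 < r := by
    have : (0 : ℝ) < r := lt_of_lt_of_le (by positivity) hr2
    exact_mod_cast this
  have hn0' : (0 : ℝ) < n := lt_of_lt_of_le (by positivity) hn
  have hn0 : 0 < n := by exact_mod_cast hn0'
  have hρm : ∀ v : InvariantFeatures.E d, Measurable fun g : G => ρ g v := fun v =>
    (hρ v).measurable
  have hρi : ∀ v : InvariantFeatures.E d, Measurable fun g : G => ρ g⁻¹ v := fun v =>
    (hρm v).comp measurable_inv
  have hstep : (1 + ε) / n ≤ 2 / 3 * ε₀ := by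
    rw [div_le_iff₀ he0'] at hn
    rw [div_le_iff₀ hn0']
    linarith [hε.2]
  set P := InvariantFeatures.sampleLaw d m r μ with hP
  -- `B₁ i`: the empirical distribution functions at `x i` are off; `B₂ (i, j)`: the average of the
  -- template kernels at `(x i, x j)` is off
  set B₁ : Fin N → Set ((Fin m → InvariantFeatures.E d) × (Fin r → G)) := fun i =>
    {ω | ε₀ / 72 ≤ InvariantFeatures.cdfDeviation ε ρ μ n (x i) ω.1 ω.2} with hB₁
  set B₂ : Fin N × Fin N → Set ((Fin m → InvariantFeatures.E d) × (Fin r → G)) := fun q =>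
    {ω | 6 * (ε₀ / 36) ≤
      |(∑ l, InvariantFeatures.templateKernel ε ρ μ n (x q.1) (x q.2) (ω.1 l)) / m -
        ∫ v, InvariantFeatures.templateKernel ε ρ μ n (x q.1) (x q.2) v
          ∂(InvariantFeatures.gaussianLaw d)|} with hB₂
  have hp1 : P.real (⋃ i, B₁ i) ≤ δ := by
    calc P.real (⋃ i, B₁ i) ≤ ∑ i, P.real (B₁ i) := measureReal_iUnion_fintype_le _
      _ ≤ ∑ _i : Fin N, 2 * Real.exp (-(2 * r * (ε₀ / 72) ^ 2)) :=
          Finset.sum_le_sum fun i _ => InvariantFeatures.measureReal_cdfDeviation_ge_le μ hρi hm0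
            hr0 (x i) (by positivity)
      _ = (N : ℝ) ^ 1 * (2 * Real.exp (-(2 * r * (ε₀ / 72) ^ 2))) := by simp
      _ ≤ δ := by
          refine InvariantFeatures.pow_mul_two_mul_exp_le hN ⟨hd0, hδ2⟩ le_rfl ?_
          rw [div_mul_eq_mul_div, div_le_iff₀ (by positivity)] at hr2
          push_cast
          linarith
  have hp2 : P.real (⋃ q, B₂ q) ≤ δ := by
    calc P.real (⋃ q, B₂ q) ≤ ∑ q, P.real (B₂ q) := measureReal_iUnion_fintype_le _
      _ ≤ ∑ _q : Fin N × Fin N, 2 * Real.exp (-(2 * m * (ε₀ / 36) ^ 2)) :=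
          Finset.sum_le_sum fun q _ =>
            InvariantFeatures.measureReal_templateKernel_deviation_ge_le μ hε hρi hn0 hm0
              (x q.1) (x q.2) (by positivity)
      _ = (N : ℝ) ^ 2 * (2 * Real.exp (-(2 * m * (ε₀ / 36) ^ 2))) := by
          simp [pow_two]
      _ ≤ δ := by
          refine InvariantFeatures.pow_mul_two_mul_exp_le hN ⟨hd0, hδ2⟩ (by norm_num) ?_
          rw [div_mul_eq_mul_div, div_le_iff₀ (by positivity)] at hm
          push_cast
          linarith
  set S := {ω : (Fin m → InvariantFeatures.E d) × (Fin r → G) | ∀ i j : Fin N,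
              ε - InvariantFeatures.delta₂ d ε - ε₀ ≤
                  inner ℝ
                      (InvariantFeatures.featureMap ρ (1 + ε) n
                        (fun l => InvariantFeatures.template ε (ω.1 l)) ω.2 (x i))
                      (InvariantFeatures.featureMap ρ (1 + ε) n
                        (fun l => InvariantFeatures.template ε (ω.1 l)) ω.2 (x j)) -
                    (1 - InvariantFeatures.orbitDist ρ μ (x i) (x j)) ∧
                inner ℝ
                      (InvariantFeatures.featureMap ρ (1 + ε) n
                        (fun l => InvariantFeatures.template ε (ω.1 l)) ω.2 (x i))
                      (InvariantFeatures.featureMap ρ (1 + ε) n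
                        (fun l => InvariantFeatures.template ε (ω.1 l)) ω.2 (x j)) -
                    (1 - InvariantFeatures.orbitDist ρ μ (x i) (x j)) ≤
                  ε₀ + ε + InvariantFeatures.delta₁ d ε} with hS
  have hcover : (Set.univ : Set ((Fin m → InvariantFeatures.E d) × (Fin r → G))) ⊆
      S ∪ ((⋃ i, B₁ i) ∪ ⋃ q, B₂ q) := by
    intro ω _
    by_cases hω : ω ∈ (⋃ i, B₁ i) ∪ ⋃ q, B₂ q
    · exact Or.inr hω
    refine Or.inl fun i j => ?_
    simp only [hB₁, hB₂, Set.mem_union, Set.mem_iUnion, Set.mem_ofPred_eq, not_or, not_exists,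
      not_le] at hω
    obtain ⟨h1, h2⟩ := hω
    have h3 := (abs_lt.1 (h2 (i, j)))
    have h4 := abs_le.1 (InvariantFeatures.abs_inner_featureMap_sub_le ρ μ hε hn0 hm0 ω.1 ω.2
      (x i) (x j))
    have h5 := InvariantFeatures.integral_templateKernel_mem_Icc μ hρm hd hε hn0 (hx i) (hx j)
    have h6 := h1 i
    have h7 := h1 j
    -- error budget: `ε₀ / 6` from the group elements, `ε₀ / 6` from the templates and
    -- `2 ε₀ / 3` from the discretization of the threshold
    constructor <;> linarith [h3.1, h3.2, h4.1, h4.2, h5.1, h5.2]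
  have hone : (1 : ℝ) = P.real Set.univ := probReal_univ.symm
  have hle := (measureReal_mono (μ := P) hcover).trans ((measureReal_union_le _ _).trans
    (add_le_add le_rfl (measureReal_union_le _ _)))
  linarith
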